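/- A signed bipartite graph $G=(V,E,\mathcal E)$ is a finite bipartite graph with colour classes $V$ and $E$ and edge set $\mathcal E$, possibly disconnected and possibly with parallel edges and isolated vertices, in which each edge is given a sign, positive or negative; $\mathcal E_-(G)$ denotes the set of negative edges. Let $H$ be a finite connected (unsigned) bipartite graph, one colour class $E$ of which is viewed as a set of hyperedges and is totally ordered. A hypertree is a vector $f\colon E\to\mathbb Z$ such that $H$ has a spanning tree with degree $f(e)+1$ at every $e\in E$. A hyperedge $e$ is internally inactive with respect to a hypertree $f$ if, for some hyperedge $e'<e$, decreasing $f(e)$ by $1$ and increasing $f(e')$ by $1$ yields a hypertree. The interior polynomial of $H$ is $I_H(x)=\sum_f x^{\bar\iota(f)}$, where $f$ runs over the hypertrees and $\bar\iota(f)$ is the number of internally inactive hyperedges with respect to $f$. For a bipartite graph $H$ with connected components $H_1,\dots,H_k$, $k\ge 1$, put $I'_H(x)=(1-x)^{k-1}\prod_{i=1}^k I_{H_i}(x)$. For a signed bipartite graph $G$ put $$I^+_G(x)=\sum_{\mathcal S\subseteq\mathcal E_-(G)}(-1)^{|\mathcal S|}\,I'_{G\setminus\mathcal S}(x),$$ where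 $G\setminus\mathcal S$ is obtained by deleting the edges in $\mathcal S$ and forgetting the signs. For a vertex $v$ of $G$, let $G-v$ be obtained from $G$ by removing $v$ and all edges incident to it, and let $G/v$ be obtained from $G-v$ by identifying all the neighbours of $v$ in $G$ to a single vertex; the remaining edges keep their signs, and both graphs inherit the colouring of $G$. **Theorem.** Let $G$ be a signed bipartite graph and let $v$ be a vertex, in either colour class, that is incident to exactly two edges $\epsilon_1,\epsilon_2$, which are not parallel. Let either one of the two colours be chosen, let the vertices of that colour be viewed as the hyperedges in $G$, $G-v$ and $G/v$, and let the vertices of each of these three graphs be totally ordered in an arbitrary way. Then - $I^+_G(x)=I^+_{G-v}(x)+x\,I^+_{G/v}(x)$ if $\epsilon_1$ and $\epsilon_2$ are both positive; - $I^+_G(x)=-x\,I^+_{G-v}(x)+x\,I^+_{G/v}(x)$ if $\epsilon_1$ and $\epsilon_2$ are both negative; - $I^+_G(x)=x\,I^+_{G/v}(x)$ if one of $\epsilon_1,\epsilon_2$ is positive and the other is negative. -/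

import Mathlib

open scoped Polynomial

/-- A bipartite graph with vertex set `W` and edge set `𝓔`, in which parallel edges and isolated
vertices are allowed and every edge carries a sign `1` or `-1`. The vertices are coloured by `Bool`;
the edge `ε` joins the vertex `ends ε false` of colour `false` to the vertex `ends ε true` of colour
`true`. -/
structure SignedBipartiteGraph (W 𝓔 : Type*) where
  color : W → Bool
  ends : 𝓔 → Bool → W
  color_ends : ∀ ε b, color (ends ε b) = b
  sign : 𝓔 → ℤˣ

section Interior

variable {W : Type*}

/-- Let `H` be a graph and let the set `E` of vertices be one of its colour classes, viewed as the
set of hyperedges. A hypertree is a vector `f` on `E` for which there is a spanning tree `T` of `H`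
with degree `f e + 1` at every `e ∈ E`. (For the one-vertex graph whose vertex is in `E`, the only
hypertree has the value `-1`; this is why `f` has integer values.) -/
def IsHypertree (H : SimpleGraph W) (E : Set W) (f : E → ℤ) : Prop :=
  ∃ T : SimpleGraph W, T ≤ H ∧ T.IsTree ∧ ∀ e : E, ((T.neighborSet e).ncard : ℤ) = f e + 1

/-- A finite graph has finitely many hypertrees, since a hypertree is determined by any spanning tree
that realizes it. -/
theorem finite_setOf_isHypertree [Finite W] (H : SimpleGraph W) (E : Set W) :
    {f : E → ℤ | IsHypertree H E f}.Finite := by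
  refine (Set.finite_range fun (T : SimpleGraph W) (e : E) =>
    ((T.neighborSet e).ncard : ℤ) - 1).subset ?_
  rintro f ⟨T, -, -, h⟩
  refine ⟨T, funext fun e => ?_⟩
  simp [h e]

open Classical in
/-- The vector obtained from `f` by decreasing its value at `e` and increasing its value at `e'`,
both by `1`. -/
noncomputable def transferUnit {E : Set W} (f : E → ℤ) (e e' : E) : E → ℤ :=
  f - Pi.single e 1 + Pi.single e' 1

/-- The hyperedge `e` is internally inactive with respect to `f` and the strict order `r` if `f` can
be turned into a hypertree by decreasing `f e` by `1` and increasing `f e'` by `1` for some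
hyperedge `e'` smaller than `e`. -/
def IsInternallyInactive (H : SimpleGraph W) (E : Set W) (r : W → W → Prop)
    (f : E → ℤ) (e : E) : Prop :=
  ∃ e' : E, r e' e ∧ IsHypertree H E (transferUnit f e e')

/-- The interior polynomial `I_H` of a finite connected bipartite graph `H`, in which the colour
class `E` is viewed as the set of hyperedges and is ordered by `r`: the sum, over all hypertrees,
of `X` to the number of internally inactive hyperedges. (The sum is finite by `finite_setOf_isHypertree`.) -/
noncomputable def interiorPoly (H : SimpleGraph W) (E : Set W) (r : W → W → Prop) : ℤ[X] :=
  ∑ᶠ (f : E → ℤ) (_ : IsHypertree H E f),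
    Polynomial.X ^ {e : E | IsInternallyInactive H E r f e}.ncard

/-- The interior polynomial `I'_H` of a finite, possibly disconnected bipartite graph with `k ≥ 1`
components: `(1 - X) ^ (k - 1)` times the product of the interior polynomials of the components. -/
noncomputable def interiorPoly' (H : SimpleGraph W) (E : Set W) (r : W → W → Prop) : ℤ[X] :=
  (1 - Polynomial.X) ^ (Nat.card H.ConnectedComponent - 1) *
    ∏ᶠ c : H.ConnectedComponent,
      interiorPoly c.toSimpleGraph {w : c | (w : W) ∈ E} (fun w w' : c => r w w')

end Interior

namespace SignedBipartiteGraph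

variable {W 𝓔 : Type*} (G : SignedBipartiteGraph W 𝓔)

/-- The edge `ε` is incident to the vertex `v`. -/
def Incident (v : W) (ε : 𝓔) : Prop := ∃ b, G.ends ε b = v

/-- Two edges are parallel if they have the same endpoints. -/
def Parallel (ε ε' : 𝓔) : Prop := G.ends ε = G.ends ε'

/-- The vertices `u` and `w` are joined by an edge. -/
def Joined (u w : W) : Prop := ∃ ε, ∃ b, G.ends ε b = u ∧ G.ends ε (!b) = w

theorem Joined.color_eq {G : SignedBipartiteGraph W 𝓔} {u w : W} (h : G.Joined u w) :
    G.color w = !G.color u := by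
  obtain ⟨ε, b, rfl, rfl⟩ := h
  simp [G.color_ends]

/-- The unsigned bipartite graph `G ∖ S`, obtained by deleting the edges in `S` and forgetting the
signs. It is recorded as a simple graph, because the multiplicity of an edge has no influence on
the induced hypergraphs, hence none on the unsigned interior polynomial. -/
def deleteEdges (S : Set 𝓔) : SimpleGraph W where
  Adj u w := ∃ ε, ε ∉ S ∧ ∃ b, G.ends ε b = u ∧ G.ends ε (!b) = w
  symm := ⟨by
    rintro u w ⟨ε, hε, b, hu, hw⟩
    exact ⟨ε, hε, !b, hw, by simpa using hu⟩⟩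
  loopless := ⟨by
    rintro u ⟨ε, -, b, hu, hw⟩
    have h := congrArg G.color (hu.trans hw.symm)
    simp [G.color_ends] at h⟩

/-- The set of negative edges. -/
def negEdges : Set 𝓔 := {ε | G.sign ε = -1}

/-- The signed interior polynomial `I⁺_G` of a finite signed bipartite graph: the alternating sum of
`I'_{G ∖ S}` over all sets `S` of negative edges. Here the vertices of colour `b` are viewed as the
hyperedges, and they are ordered by `r`. -/
noncomputable def signedInteriorPoly (b : Bool) (r : W → W → Prop) : ℤ[X] :=
  ∑ᶠ (S : Set 𝓔) (_ : S ⊆ G.negEdges),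
    (-1) ^ S.ncard * interiorPoly' (G.deleteEdges S) {w | G.color w = b} r

/-- The graph `G - v`, obtained by removing the vertex `v` and all edges incident to it. -/
def deleteVertex (v : W) :
    SignedBipartiteGraph {w : W // w ≠ v} {ε : 𝓔 // ¬ G.Incident v ε} where
  color w := G.color w
  ends ε b := ⟨G.ends ε b, fun h => ε.2 ⟨b, h⟩⟩
  color_ends ε b := G.color_ends ε b
  sign ε := G.sign ε

/-- Two vertices of `G - v` are identified if they are equal or both joined to `v` in `G`. -/
def contractSetoid (v : W) : Setoid {w : W // w ≠ v} where
  r u w := u = w ∨ (G.Joined v u ∧ G.Joined v w)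
  iseqv :=
    { refl := fun _ => Or.inl rfl
      symm := by
        rintro u w (h | ⟨h, h'⟩)
        · exact Or.inl h.symm
        · exact Or.inr ⟨h', h⟩
      trans := by
        rintro u w x (rfl | ⟨h, h'⟩) (rfl | ⟨k, k'⟩)
        · exact Or.inl rfl
        · exact Or.inr ⟨k, k'⟩
        · exact Or.inr ⟨h, h'⟩
        · exact Or.inr ⟨h, k'⟩ }

/-- The graph `G / v`, obtained from `G - v` by identifying all the vertices that are joined to `v`
in `G` with each other. -/
def contractVertex (v : W) :
    SignedBipartiteGraph (Quotient (G.contractSetoid v)) {ε : 𝓔 // ¬ G.Incident v ε} where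
  color := Quotient.lift (G.deleteVertex v).color (by
    rintro u w (rfl | ⟨h, h'⟩)
    · rfl
    · exact h.color_eq.trans h'.color_eq.symm)
  ends ε b := Quotient.mk (G.contractSetoid v) ((G.deleteVertex v).ends ε b)
  color_ends ε b := (G.deleteVertex v).color_ends ε b
  sign ε := G.sign ε

end SignedBipartiteGraph

/-! Everything reduces to three facts about the unsigned polynomial `interiorPoly'` at a vertex v.
If v is isolated, removing it costs a factor 1 - X (`interiorPoly'_of_isolated`). If v is a leaf,
removing it changes nothing (`interiorPoly'_of_leaf`). If v has two neighbours, then I'(H) = I'(H -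
v) + X I'(H / v) (`interiorPoly'_of_two`). The subsets of the negative edges are grouped by which
edges at v they contain. With A and B the contributions of G - v and G / v, the groups give A + XB
for two positive edges, (A + XB) - A for opposite signs, and (A + XB) - A - A + (1 - X)A for two
negative edges.

To prove the three facts, activities are replaced by a sum that involves no order. Put q = 1 - X. In
a connected hypergraph with n vertices and no empty hyperedge, the draconian vectors are the natural
vectors lying below some hypertree. Each of them lies below exactly one hypertree f that it equals
at all internally inactive hyperedges of f (`IsDraconian.exists_greedy_base`,
`IsDraconianBase.eq_of_greedy`). So the draconian vectors split into boxes, one per hypertree. The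
weight `multWeight` telescopes, and the box of f has total weight (1 - q)^(number of inactive
hyperedges) times q^(-(n - 1)). Hence q I = q^n `draconianSum` (`interiorPoly_of_connected`).
Draconian sums are multiplicative over components, and the powers of 1 - X in I' are absorbed by the
factors q, so the formula holds for disconnected graphs too (`interiorPoly'_eq_draconianSum`).

Draconian sums can be computed locally. For fixed values at the other hyperedges, the admissible
values at one hyperedge form an interval, and its weights add up to a power of q
(`draconianSum_option`). If v is a hyperedge with two vertices, that power is 1 or q⁻¹ = 1 + (1 -
q)q⁻¹, and the second case occurs exactly for the vectors that stay draconian when the two vertices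
are identified (`draconianSum_of_two_vertices`). If v lies in two hyperedges, a double summation is
needed. Its value depends linearly on a defect of submodularity that v raises by one, and the
increment is the sum for the merged hyperedge (`draconianSum_of_two_hyperedges`).

That hypertrees are the integer solutions of the expected inequalities is `isHypertree_iff`. -/

/-! ### Draconian vectors and their weighted sum -/

section Draconian

/-- A vector `g` on the hyperedges of a hypergraph is draconian if every set `A` of hyperedges on
which it does not vanish has more than `g A` vertices; `ρ A` is the number of vertices of `A`. -/
def IsDraconian {E : Type*} (ρ : Finset E → ℕ) (g : E → ℕ) : Prop :=
  ∀ A : Finset E, 0 < ∑ e ∈ A, g e → ∑ e ∈ A, g e < ρ A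

theorem IsDraconian.sum_le {E : Type*} {ρ : Finset E → ℕ} {g : E → ℕ} (h : IsDraconian ρ g)
    (A : Finset E) : ∑ e ∈ A, g e ≤ ρ A := by
  have := h A
  omega

theorem finite_setOf_isDraconian {E : Type*} [Finite E] (ρ : Finset E → ℕ) :
    {g : E → ℕ | IsDraconian ρ g}.Finite := by
  refine (Set.Finite.pi' fun e => Set.finite_Iic (ρ {e})).subset fun g hg e => ?_
  simpa using hg.sum_le {e}

/-- The draconian vectors of a finite hypergraph, as a finset. -/
noncomputable def draconianVectors {E : Type*} [Finite E] (ρ : Finset E → ℕ) : Finset (E → ℕ) :=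
  (finite_setOf_isDraconian ρ).toFinset

@[simp]
theorem mem_draconianVectors {E : Type*} [Finite E] {ρ : Finset E → ℕ} {g : E → ℕ} :
    g ∈ draconianVectors ρ ↔ IsDraconian ρ g := by
  simp [draconianVectors]

variable {F : Type*} [Field F]

/-- The weight of a multiplicity: `1` for `0` and `(1 - q) / q ^ k` for `k > 0`. -/
noncomputable def multWeight (q : F) (k : ℕ) : F := if k = 0 then 1 else (1 - q) * q⁻¹ ^ k

@[simp]
theorem multWeight_zero (q : F) : multWeight q 0 = 1 := by simp [multWeight]

theorem multWeight_of_pos (q : F) {k : ℕ} (hk : 0 < k) : multWeight q k = (1 - q) * q⁻¹ ^ k := by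
  simp [multWeight, hk.ne']

/-- The weight of k > 0 is the difference of q⁻¹ ^ k and q⁻¹ ^ (k - 1), so the sum telescopes. -/
theorem sum_range_succ_multWeight {q : F} (hq : q ≠ 0) (m : ℕ) :
    ∑ k ∈ Finset.range (m + 1), multWeight q k = q⁻¹ ^ m := by
  induction m with
  | zero => simp
  | succ m ih =>
    rw [Finset.sum_range_succ, ih, multWeight_of_pos q m.succ_pos, pow_succ]
    field_simp
    ring

/-- The weighted sum over the draconian vectors, with an extra factor `q` for every hyperedge
without vertices. -/
noncomputable def draconianSum {E : Type*} [Fintype E] (q : F) (ρ : Finset E → ℕ) : F :=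
  (∏ e, if ρ {e} = 0 then q else 1) * ∑ g ∈ draconianVectors ρ, ∏ e, multWeight q (g e)

theorem draconianSum_congr {E E' : Type*} [Fintype E] [Fintype E'] (q : F) (φ : E' ≃ E)
    {ρ : Finset E → ℕ} {ρ' : Finset E' → ℕ} (h : ∀ A, ρ' A = ρ (A.map φ.toEmbedding)) :
    draconianSum q ρ' = draconianSum q ρ := by
  have key : ∀ g : E → ℕ, IsDraconian ρ' (g ∘ φ) ↔ IsDraconian ρ g := by
    intro g
    constructor
    · intro hg A
      have := hg (A.map φ.symm.toEmbedding)
      rw [h, Finset.map_map] at this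
      simpa [← Equiv.trans_toEmbedding] using this
    · intro hg A
      have := hg (A.map φ.toEmbedding)
      rw [← h] at this
      simpa using this
  unfold draconianSum
  congr 1
  · refine Fintype.prod_equiv φ _ _ fun e => ?_
    simp [h]
  · symm
    refine Finset.sum_nbij' (fun g => g ∘ φ) (fun g => g ∘ φ.symm) ?_ ?_ ?_ ?_ ?_
    · intro g hg
      simpa [key] using hg
    · intro g hg
      simp only [mem_draconianVectors] at hg ⊢
      rw [← key]
      simpa [Function.comp_assoc] using hg
    · intro g _
      simp [Function.comp_assoc]
    · intro g _
      simp [Function.comp_assoc]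
    · intro g _
      exact (Fintype.prod_equiv φ _ _ fun e => rfl).symm

/-- Both sides of the inequality are additive over the parts. A set on which g does not vanish has a
part with the same property; the inequality is strict there and weak elsewhere. Conversely, a set in
one part is tested by leaving the other parts empty. -/
theorem isDraconian_sigma {ι : Type*} [Fintype ι] {E : ι → Type*}
    {ρ : Finset (Σ i, E i) → ℕ} {ρ' : ∀ i, Finset (E i) → ℕ}
    (h : ∀ A : ∀ i, Finset (E i), ρ (Finset.univ.sigma A) = ∑ i, ρ' i (A i))
    (h0 : ∀ i, ρ' i ∅ = 0) (g : (Σ i, E i) → ℕ) :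
    IsDraconian ρ g ↔ ∀ i, IsDraconian (ρ' i) fun e => g ⟨i, e⟩ := by
  classical
  constructor
  · intro hg i A
    have := hg (Finset.univ.sigma (Function.update (fun _ => ∅) i A))
    rw [h, Finset.sum_sigma, Fintype.sum_eq_single i, Fintype.sum_eq_single i] at this
    · simpa using this
    · intro j hj
      simp [hj, h0]
    · intro j hj
      simp [hj]
  · intro hg A hA
    have hs : A = Finset.univ.sigma fun i =>
        A.preimage (Sigma.mk i) sigma_mk_injective.injOn := by
      ext ⟨i, e⟩
      simp
    rw [hs, Finset.sum_sigma] at hA ⊢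
    rw [h]
    obtain ⟨i, hi, hpos⟩ := Finset.exists_ne_zero_of_sum_ne_zero hA.ne'
    exact Finset.sum_lt_sum (fun j _ => (hg j).sum_le _) ⟨i, hi, hg i _ (Nat.pos_of_ne_zero hpos)⟩

theorem draconianSum_sigma {ι : Type*} [Fintype ι] {E : ι → Type*} [∀ i, Fintype (E i)] (q : F)
    {ρ : Finset (Σ i, E i) → ℕ} {ρ' : ∀ i, Finset (E i) → ℕ}
    (h : ∀ A : ∀ i, Finset (E i), ρ (Finset.univ.sigma A) = ∑ i, ρ' i (A i))
    (h0 : ∀ i, ρ' i ∅ = 0) :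
    draconianSum q ρ = ∏ i, draconianSum q (ρ' i) := by
  classical
  unfold draconianSum
  rw [Finset.prod_mul_distrib, Fintype.prod_sigma, Finset.prod_univ_sum]
  congr 1
  · refine Finset.prod_congr rfl fun i _ => Finset.prod_congr rfl fun e _ => ?_
    have := h (Function.update (fun _ => ∅) i {e})
    rw [Fintype.sum_eq_single i fun j hj => by simp [hj, h0]] at this
    rw [show ({⟨i, e⟩} : Finset (Σ i, E i)) =
      Finset.univ.sigma (Function.update (fun _ => ∅) i {e}) from ?_, this]
    · simp
    · ext ⟨j, e'⟩
      by_cases hj : j = i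
      · subst hj
        simp
      · simp [hj]
  · refine Finset.sum_nbij' (fun g i e => g ⟨i, e⟩) (fun g p => g p.1 p.2) ?_ ?_ ?_ ?_ ?_
    · intro g hg
      simpa [isDraconian_sigma h h0] using hg
    · intro g hg
      simpa [isDraconian_sigma h h0] using hg
    · intro g _
      rfl
    · intro g _
      rfl
    · intro g _
      exact Fintype.prod_sigma _

/-! ### Summation over the value at one or two hyperedges -/

section Slice

/-- The restriction of `ρ` to the sets that avoid `none`. -/
def restrictSome {E : Type*} (ρ : Finset (Option E) → ℕ) (A : Finset E) : ℕ :=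
  ρ (A.map Function.Embedding.some)

theorem monotone_restrictSome {E : Type*} {ρ : Finset (Option E) → ℕ} (hρ : Monotone ρ) :
    Monotone (restrictSome ρ) :=
  fun _ _ h => hρ (Finset.map_subset_map.2 h)

theorem restrictSome_le {E : Type*} {ρ : Finset (Option E) → ℕ} (hρ : Monotone ρ) (A : Finset E) :
    restrictSome ρ A ≤ ρ (Finset.insertNone A) := by
  refine hρ fun x hx => ?_
  obtain ⟨a, ha, rfl⟩ := Finset.mem_map.1 hx
  exact Finset.some_mem_insertNone.2 ha

theorem sum_insertNone {E : Type*} (A : Finset E) (g : Option E → ℕ) :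
    ∑ e ∈ Finset.insertNone A, g e = g none + ∑ e ∈ A, g (some e) := by
  simp [Finset.insertNone]

theorem insertNone_empty {E : Type*} : Finset.insertNone (∅ : Finset E) = {none} := by
  ext x
  cases x <;> simp

theorem finset_option_cases {E : Type*} (A : Finset (Option E)) :
    (∃ B : Finset E, A = B.map Function.Embedding.some) ∨ ∃ B, A = Finset.insertNone B := by
  classical
  by_cases h : none ∈ A
  · exact Or.inr ⟨Finset.eraseNone A, by
      rw [Finset.insertNone_eraseNone, Finset.insert_eq_of_mem h]⟩
  · exact Or.inl ⟨Finset.eraseNone A, by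
      rw [Finset.map_some_eraseNone, Finset.erase_eq_of_notMem h]⟩

variable {E : Type*} [Fintype E]

/-- The minimum of `τ A - g A` over all sets `A`. If `τ A` is the number of vertices of `A` together
with one more hyperedge, then this bounds the values of draconian extensions of `g` there. -/
def sliceBound (τ : Finset E → ℕ) (g : E → ℕ) : ℕ :=
  Finset.univ.inf' Finset.univ_nonempty fun A : Finset E => τ A - ∑ e ∈ A, g e

theorem exists_sliceBound_eq (τ : Finset E → ℕ) (g : E → ℕ) :
    ∃ A, sliceBound τ g = τ A - ∑ e ∈ A, g e := by
  obtain ⟨A, -, hA⟩ := Finset.exists_mem_eq_inf' Finset.univ_nonempty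
    fun A : Finset E => τ A - ∑ e ∈ A, g e
  exact ⟨A, hA⟩

theorem le_sliceBound_iff {τ : Finset E → ℕ} {g : E → ℕ} {n : ℕ} :
    n ≤ sliceBound τ g ↔ ∀ A, n ≤ τ A - ∑ e ∈ A, g e := by
  simp [sliceBound]

theorem sliceBound_le (τ : Finset E → ℕ) (g : E → ℕ) (A : Finset E) :
    sliceBound τ g ≤ τ A - ∑ e ∈ A, g e :=
  le_sliceBound_iff.1 le_rfl A

/-- The hypothesis `hg` keeps the natural subtraction from truncating; otherwise the minimum need
not move. -/
theorem sliceBound_add_one {τ τ' : Finset E → ℕ} {g : E → ℕ} (h : ∀ A, τ' A = τ A + 1)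
    (hg : ∀ A, ∑ e ∈ A, g e ≤ τ A) : sliceBound τ' g = sliceBound τ g + 1 := by
  apply le_antisymm
  · obtain ⟨A, hA⟩ := exists_sliceBound_eq τ g
    have := sliceBound_le τ' g A
    have := h A
    have := hg A
    omega
  · refine le_sliceBound_iff.2 fun A => ?_
    have := sliceBound_le τ g A
    have := h A
    have := hg A
    omega

theorem sliceBound_option (τ : Finset (Option E) → ℕ) (g : Option E → ℕ) :
    sliceBound τ g = min (sliceBound (restrictSome τ) fun e => g (some e))
      ((sliceBound (fun A => τ (Finset.insertNone A)) fun e => g (some e)) - g none) := by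
  apply le_antisymm
  · refine le_min (le_sliceBound_iff.2 fun A => ?_) ?_
    · simpa [restrictSome] using sliceBound_le τ g (A.map Function.Embedding.some)
    · obtain ⟨A, hA⟩ := exists_sliceBound_eq (fun A => τ (Finset.insertNone A))
        fun e => g (some e)
      have := sliceBound_le τ g (Finset.insertNone A)
      rw [sum_insertNone] at this
      omega
  · refine le_sliceBound_iff.2 fun A => ?_
    obtain ⟨B, rfl⟩ | ⟨B, rfl⟩ := finset_option_cases A
    · refine (min_le_left _ _).trans ?_
      simpa [restrictSome] using sliceBound_le (restrictSome τ) (fun e => g (some e)) B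
    · refine (min_le_right _ _).trans ?_
      have := sliceBound_le (fun A => τ (Finset.insertNone A)) (fun e => g (some e)) B
      rw [sum_insertNone]
      omega

/-- A set on which g is positive leaves a positive difference because g is draconian, so only sets
on which g vanishes can give 0. For those the difference is at least `ρ {none}`, with equality at
the empty set. -/
theorem sliceBound_eq_zero_iff {ρ : Finset (Option E) → ℕ} (hρ : Monotone ρ) {g : E → ℕ}
    (hg : IsDraconian (restrictSome ρ) g) :
    sliceBound (fun A => ρ (Finset.insertNone A)) g = 0 ↔ ρ {none} = 0 := by
  constructor
  · intro h
    obtain ⟨A, hA⟩ := exists_sliceBound_eq (fun A => ρ (Finset.insertNone A)) g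
    have h1 := restrictSome_le hρ A
    have h2 := hg A
    have h3 : ρ {none} ≤ ρ (Finset.insertNone A) := hρ (by simp)
    omega
  · intro h
    have := sliceBound_le (fun A => ρ (Finset.insertNone A)) g ∅
    rw [insertNone_empty, h] at this
    omega

/-- A positive value at `none` must be smaller than every difference over sets containing `none`.
The value 0 is always allowed, by monotonicity of ρ, even when the bound is 0; hence the maximum
with 1. -/
theorem isDraconian_option_iff {ρ : Finset (Option E) → ℕ} (hρ : Monotone ρ) (g : Option E → ℕ) :
    IsDraconian ρ g ↔ IsDraconian (restrictSome ρ) (fun e => g (some e)) ∧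
      g none < max (sliceBound (fun A => ρ (Finset.insertNone A)) fun e => g (some e)) 1 := by
  constructor
  · intro hg
    refine ⟨fun A => by simpa [restrictSome] using hg (A.map Function.Embedding.some), ?_⟩
    obtain ⟨A, hA⟩ := exists_sliceBound_eq (fun A => ρ (Finset.insertNone A)) fun e => g (some e)
    have := hg (Finset.insertNone A)
    rw [sum_insertNone] at this
    rw [hA]
    omega
  · rintro ⟨hg, hn⟩ A hA
    obtain ⟨B, rfl⟩ | ⟨B, rfl⟩ := finset_option_cases A
    · simp only [Finset.sum_map] at hA ⊢
      exact hg _ hA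
    · rw [sum_insertNone] at hA ⊢
      have h1 := sliceBound_le (fun A => ρ (Finset.insertNone A)) (fun e => g (some e)) B
      have h2 := restrictSome_le hρ B
      have h3 := hg B
      simp only at h1 h3
      omega

theorem sum_draconianVectors_option {ρ : Finset (Option E) → ℕ} (hρ : Monotone ρ)
    (ψ : (Option E → ℕ) → F) :
    ∑ g ∈ draconianVectors ρ, ψ g = ∑ g ∈ draconianVectors (restrictSome ρ),
      ∑ k ∈ Finset.range (max (sliceBound (fun A => ρ (Finset.insertNone A)) g) 1),
        ψ fun o => o.elim k g := by
  rw [Finset.sum_sigma']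
  have hs : ∀ g : Option E → ℕ, (fun o : Option E => o.elim (g none) fun e => g (some e)) = g := by
    intro g
    funext o
    cases o <;> rfl
  refine Finset.sum_nbij' (fun g => ⟨fun e => g (some e), g none⟩)
    (fun p o => o.elim p.2 p.1) ?_ ?_ ?_ ?_ ?_
  · intro g hg
    simpa [isDraconian_option_iff hρ] using hg
  · rintro ⟨g, k⟩ hg
    simpa [isDraconian_option_iff hρ] using hg
  · intro g _
    exact hs g
  · rintro ⟨g, k⟩ _
    rfl
  · intro g _
    rw [hs]

/-- This is the purpose of the factor q for hyperedges without vertices: the same power of q then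
describes the slice when the bound is 0. -/
theorem sum_multWeight_slice {q : F} (hq : q ≠ 0) (a : ℕ) :
    (if a = 0 then q else 1) * ∑ k ∈ Finset.range (max a 1), multWeight q k = q * q⁻¹ ^ a := by
  rcases a with _ | m
  · simp
  · rw [if_neg m.succ_ne_zero, max_eq_left (by omega), sum_range_succ_multWeight hq, pow_succ]
    field_simp

/-- Summation over the value at `none`. -/
theorem draconianSum_option {q : F} (hq : q ≠ 0) {ρ : Finset (Option E) → ℕ} (hρ : Monotone ρ) :
    draconianSum q ρ = (∏ e : E, if ρ {some e} = 0 then q else 1) *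
      ∑ g ∈ draconianVectors (restrictSome ρ), (∏ e, multWeight q (g e)) *
        (q * q⁻¹ ^ sliceBound (fun A => ρ (Finset.insertNone A)) g) := by
  unfold draconianSum
  rw [sum_draconianVectors_option hρ, Fintype.prod_option, mul_comm (ite _ _ _), mul_assoc,
    Finset.mul_sum]
  congr 1
  refine Finset.sum_congr rfl fun g hg => ?_
  rw [mem_draconianVectors] at hg
  rw [← sum_multWeight_slice hq]
  simp only [sliceBound_eq_zero_iff hρ hg, Fintype.prod_option, Option.elim, ← Finset.sum_mul]
  ring

/-- The sum over a second coordinate, when the first coordinate has already been summed over. -/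
theorem sum_multWeight_slice_slice {q : F} (hq : q ≠ 0) {a b c : ℕ} (hac : a ≤ c) (hbc : b ≤ c)
    (hcab : c ≤ a + b) :
    (if b = 0 then q else 1) *
        ∑ k ∈ Finset.range (max b 1), multWeight q k * (q * q⁻¹ ^ min a (c - k)) =
      q * q⁻¹ ^ c * (1 + (1 - q) * ((a : F) + b - c - 1)) := by
  rcases b with _ | b
  · obtain rfl : a = c := by omega
    simp
    ring
  rw [if_neg b.succ_ne_zero, max_eq_left (by omega), one_mul]
  obtain ⟨d, rfl⟩ : ∃ d, c = a + d := ⟨c - a, by omega⟩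
  -- The original second bound is b + 1. If b < d, the hypotheses force d = b + 1, and the minimum
  -- is a in every term.
  rcases Nat.lt_or_ge b d with hb | hb
  · obtain rfl : d = b + 1 := by omega
    have : ∀ k ∈ Finset.range (b + 1), multWeight q k * (q * q⁻¹ ^ min a (a + (b + 1) - k)) =
        multWeight q k * (q * q⁻¹ ^ a) := by
      intro k hk
      rw [Finset.mem_range] at hk
      rw [min_eq_left (by omega)]
    rw [Finset.sum_congr rfl this, ← Finset.sum_mul, sum_range_succ_multWeight hq]
    push_cast
    rw [pow_add q⁻¹ a, pow_succ]
    field_simp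
    ring
  · clear hcab
    induction b, hb using Nat.le_induction with
    | base =>
      rw [Finset.sum_range_succ]
      have : ∀ k ∈ Finset.range d, multWeight q k * (q * q⁻¹ ^ min a (a + d - k)) =
          multWeight q k * (q * q⁻¹ ^ a) := by
        intro k hk
        rw [Finset.mem_range] at hk
        rw [min_eq_left (by omega)]
      rw [Finset.sum_congr rfl this, ← Finset.sum_mul]
      rcases d with _ | d
      · simp
      · rw [sum_range_succ_multWeight hq, multWeight_of_pos q d.succ_pos, min_eq_left (by omega)]
        push_cast
        rw [pow_add q⁻¹ a, pow_succ]
        field_simp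
        ring
    | succ b hb ih =>
      -- Past c - a the minimum is c - k, and its power of q compensates the weight of k. Each
      -- further term is (1 - q) q q⁻¹ ^ c, so the sum grows linearly in b.
      rw [Finset.sum_range_succ, ih (by omega), multWeight_of_pos q b.succ_pos,
        show min a (a + d - (b + 1)) = a + d - (b + 1) by omega]
      obtain ⟨m, hm⟩ : ∃ m, a + d = m + (b + 1) := ⟨a + d - (b + 1), by omega⟩
      rw [hm, Nat.add_sub_cancel, Nat.succ_eq_add_one, pow_add q⁻¹ m]
      push_cast
      ring

end Slice

end Draconian

/-! ### Effect of a small hyperedge or vertex on the draconian sum -/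

section LocalIdentities

variable {F : Type*} [Field F] {E : Type*} [Fintype E]

/-- A new hyperedge without vertices. -/
theorem draconianSum_of_isolated_hyperedge {q : F} (hq : q ≠ 0) {ρ : Finset (Option E) → ℕ}
    (hρ : Monotone ρ) (h : ρ {none} = 0) :
    draconianSum q ρ = q * draconianSum q (restrictSome ρ) := by
  rw [draconianSum_option hq hρ, draconianSum, mul_left_comm q]
  congr 1
  rw [Finset.mul_sum]
  refine Finset.sum_congr rfl fun g hg => ?_
  rw [(sliceBound_eq_zero_iff hρ (mem_draconianVectors.1 hg)).2 h]
  ring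

/-- A new hyperedge with a single vertex. -/
theorem draconianSum_of_leaf_hyperedge {q : F} (hq : q ≠ 0) {ρ : Finset (Option E) → ℕ}
    (hρ : Monotone ρ) (h : ρ {none} = 1) :
    draconianSum q ρ = draconianSum q (restrictSome ρ) := by
  rw [draconianSum_option hq hρ, draconianSum]
  congr 1
  refine Finset.sum_congr rfl fun g hg => ?_
  have h0 := sliceBound_eq_zero_iff hρ (mem_draconianVectors.1 hg)
  have h1 := sliceBound_le (fun A => ρ (Finset.insertNone A)) g ∅
  rw [insertNone_empty, h] at h1
  have : sliceBound (fun A => ρ (Finset.insertNone A)) g = 1 := by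
    simp at h1
    omega
  rw [this, pow_one, mul_inv_cancel₀ hq, mul_one]

/-- A new hyperedge with two vertices, which are identified in the hypergraph of `ρ'`. -/
theorem draconianSum_of_two_vertices {q : F} (hq : q ≠ 0) {ρ : Finset (Option E) → ℕ}
    (hρ : Monotone ρ) {ρ' : Finset E → ℕ} (h : ρ {none} = 2)
    (h0 : ∀ e, ρ' {e} = 0 ↔ ρ {some e} = 0) (hle : ∀ A, ρ' A ≤ restrictSome ρ A)
    (h' : ∀ A, ρ (Finset.insertNone A) = ρ' A + 1 ∨
      (ρ (Finset.insertNone A) = ρ' A + 2 ∧ restrictSome ρ A = ρ' A)) :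
    draconianSum q ρ = draconianSum q (restrictSome ρ) + (1 - q) * q⁻¹ * draconianSum q ρ' := by
  classical
  have hsub : draconianVectors ρ' =
      (draconianVectors (restrictSome ρ)).filter fun g => IsDraconian ρ' g := by
    ext g
    simp only [mem_draconianVectors, Finset.mem_filter]
    exact ⟨fun hg => ⟨fun A hA => (hg A hA).trans_le (hle A), hg⟩, fun hg => hg.2⟩
  -- The empty set bounds the slice by 2. A set that violates the condition for ρ' while g is
  -- draconian for ρ must lose a vertex under the identification, so the first alternative of `h'`
  -- applies to it and the bound drops to 1.
  have hb : ∀ g ∈ draconianVectors (restrictSome ρ),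
      sliceBound (fun A => ρ (Finset.insertNone A)) g = if IsDraconian ρ' g then 2 else 1 := by
    intro g hg
    rw [mem_draconianVectors] at hg
    have h1 := sliceBound_eq_zero_iff hρ hg
    have h2 := sliceBound_le (fun A => ρ (Finset.insertNone A)) g ∅
    rw [insertNone_empty, h] at h2
    simp only [Finset.sum_empty] at h2
    split_ifs with hg'
    · refine le_antisymm h2 (le_sliceBound_iff.2 fun A => ?_)
      have h3 : ρ {none} ≤ ρ (Finset.insertNone A) := hρ (by simp)
      have h4 := hg' A
      have h5 := h' A
      omega
    · unfold IsDraconian at hg'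
      push Not at hg'
      obtain ⟨A, hA, hA'⟩ := hg'
      have h3 := sliceBound_le (fun A => ρ (Finset.insertNone A)) g A
      have h4 := hg A
      have h5 := h' A
      omega
  have hi : ∏ e, (if ρ' {e} = 0 then q else 1) = ∏ e, (if ρ {some e} = 0 then q else 1) := by
    simp only [h0]
  rw [draconianSum_option hq hρ, draconianSum, draconianSum, hi, hsub, Finset.sum_filter]
  simp only [restrictSome, Finset.map_singleton, Function.Embedding.some_apply]
  rw [mul_left_comm ((1 - q) * q⁻¹), ← mul_add]
  congr 1
  rw [Finset.mul_sum, ← Finset.sum_add_distrib]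
  refine Finset.sum_congr rfl fun g hg => ?_
  rw [hb g hg]
  -- The slice contributes q q⁻¹ ^ 2 = 1 + (1 - q) q⁻¹ for bound 2, and 1 for bound 1.
  split_ifs
  · field_simp
    ring
  · field_simp
    ring

/-- A new vertex that belongs to the hyperedge `none` only. -/
theorem draconianSum_of_leaf_vertex {q : F} (hq : q ≠ 0) {ρ ρ₀ : Finset (Option E) → ℕ}
    (hρ : Monotone ρ) (hρ₀ : Monotone ρ₀) (h : restrictSome ρ = restrictSome ρ₀)
    (h' : ∀ A, ρ (Finset.insertNone A) = ρ₀ (Finset.insertNone A) + 1) :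
    q * draconianSum q ρ = draconianSum q ρ₀ := by
  have hi : ∀ e, ρ {some e} = ρ₀ {some e} := fun e => by simpa [restrictSome] using congrFun h {e}
  rw [draconianSum_option hq hρ, draconianSum_option hq hρ₀, mul_left_comm q, h]
  simp only [hi]
  congr 1
  rw [Finset.mul_sum]
  refine Finset.sum_congr rfl fun g hg => ?_
  rw [mem_draconianVectors] at hg
  rw [sliceBound_add_one (τ := fun A => ρ₀ (Finset.insertNone A)) h'
    fun A => (hg.sum_le A).trans (restrictSome_le hρ₀ A), pow_succ]
  field_simp

/-- Summation over the values at the first two hyperedges. -/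
theorem draconianSum_option_option [DecidableEq E] {q : F} (hq : q ≠ 0) {ρ : Finset (Option (Option E)) → ℕ}
    (hρ : Monotone ρ)
    (hsub : ∀ A B : Finset E, ρ (Finset.insertNone (Finset.insertNone (A ∪ B))) +
      ρ (((A ∩ B).map Function.Embedding.some).map Function.Embedding.some) ≤
      ρ (Finset.insertNone (A.map Function.Embedding.some)) +
        ρ ((Finset.insertNone B).map Function.Embedding.some)) :
    draconianSum q ρ = (∏ e : E, if ρ {some (some e)} = 0 then q else 1) *
      ∑ g ∈ draconianVectors (restrictSome (restrictSome ρ)), (∏ e, multWeight q (g e)) *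
        (q * q⁻¹ ^ sliceBound (fun A => ρ (Finset.insertNone (Finset.insertNone A))) g *
          (1 + (1 - q) *
            ((sliceBound (fun A => ρ (Finset.insertNone (A.map Function.Embedding.some))) g : F) +
              sliceBound (fun A => ρ ((Finset.insertNone A).map Function.Embedding.some)) g -
              sliceBound (fun A => ρ (Finset.insertNone (Finset.insertNone A))) g - 1))) := by
  have hρ' := monotone_restrictSome hρ
  rw [draconianSum_option hq hρ, sum_draconianVectors_option hρ', Fintype.prod_option,
    mul_comm (ite _ _ _), mul_assoc, Finset.mul_sum]
  congr 1
  refine Finset.sum_congr rfl fun g hg => ?_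
  rw [mem_draconianVectors] at hg
  have hb := sliceBound_eq_zero_iff hρ' hg
  have hmap : ∀ A : Finset E, A.map Function.Embedding.some ⊆ Finset.insertNone A := fun A x hx => by
    obtain ⟨a, ha, rfl⟩ := Finset.mem_map.1 hx
    exact Finset.some_mem_insertNone.2 ha
  have hac : sliceBound (fun A => ρ (Finset.insertNone (A.map Function.Embedding.some))) g ≤
      sliceBound (fun A => ρ (Finset.insertNone (Finset.insertNone A))) g := by
    refine le_sliceBound_iff.2 fun A => ?_
    have h1 := sliceBound_le (fun A => ρ (Finset.insertNone (A.map Function.Embedding.some))) g A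
    have h2 : ρ (Finset.insertNone (A.map Function.Embedding.some)) ≤
        ρ (Finset.insertNone (Finset.insertNone A)) := hρ (Finset.insertNone.monotone (hmap A))
    omega
  have hbc : sliceBound (fun A => ρ ((Finset.insertNone A).map Function.Embedding.some)) g ≤
      sliceBound (fun A => ρ (Finset.insertNone (Finset.insertNone A))) g := by
    refine le_sliceBound_iff.2 fun A => ?_
    have h1 := sliceBound_le (fun A => ρ ((Finset.insertNone A).map Function.Embedding.some)) g A
    have h2 := restrictSome_le hρ (Finset.insertNone A)
    simp only [restrictSome] at h1 h2
    omega
  -- Submodularity at minimizers A and B of the two bounds: A ∪ B tests the left side, and the term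
  -- for A ∩ B is nonnegative because g is draconian.
  have hcab : sliceBound (fun A => ρ (Finset.insertNone (Finset.insertNone A))) g ≤
      sliceBound (fun A => ρ (Finset.insertNone (A.map Function.Embedding.some))) g +
        sliceBound (fun A => ρ ((Finset.insertNone A).map Function.Embedding.some)) g := by
    obtain ⟨A, hA⟩ :=
      exists_sliceBound_eq (fun A => ρ (Finset.insertNone (A.map Function.Embedding.some))) g
    obtain ⟨B, hB⟩ :=
      exists_sliceBound_eq (fun A => ρ ((Finset.insertNone A).map Function.Embedding.some)) g
    have h1 := sliceBound_le (fun A => ρ (Finset.insertNone (Finset.insertNone A))) g (A ∪ B)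
    have h2 := hg.sum_le (A ∩ B)
    have h3 := hsub A B
    have h4 := Finset.sum_union_inter (s₁ := A) (s₂ := B) (f := g)
    simp only [restrictSome] at h1 h2
    omega
  have hsl : ∀ k, (sliceBound (fun A => ρ (Finset.insertNone A)) fun o : Option E => o.elim k g) =
      min (sliceBound (fun A => ρ (Finset.insertNone (A.map Function.Embedding.some))) g)
        (sliceBound (fun A => ρ (Finset.insertNone (Finset.insertNone A))) g - k) :=
    fun k => sliceBound_option _ _
  rw [← sum_multWeight_slice_slice hq hac hbc hcab]
  simp only [hsl, Fintype.prod_option, Option.elim_none, Option.elim_some]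
  rw [mul_left_comm, Finset.mul_sum]
  simp only [restrictSome, Finset.map_singleton, Function.Embedding.some_apply] at hb ⊢
  simp only [hb, mul_assoc, Finset.mul_sum, mul_left_comm (∏ e, multWeight q (g e))]

/-- A new vertex that belongs to two hyperedges, which are merged in the hypergraph of `ρ'`. -/
theorem draconianSum_of_two_hyperedges [DecidableEq E] {q : F} (hq : q ≠ 0)
    {ρ ρ₀ : Finset (Option (Option E)) → ℕ} {ρ' : Finset (Option E) → ℕ}
    (hρ : Monotone ρ) (hρ₀ : Monotone ρ₀) (hρ' : Monotone ρ')
    (hsub : ∀ A B : Finset (Option (Option E)),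
      ρ₀ (A ∪ B) + ρ₀ (A ∩ B) ≤ ρ₀ A + ρ₀ B)
    (h00 : restrictSome (restrictSome ρ) = restrictSome (restrictSome ρ₀))
    (h10 : ∀ A : Finset E, ρ (Finset.insertNone (A.map Function.Embedding.some)) =
      ρ₀ (Finset.insertNone (A.map Function.Embedding.some)) + 1)
    (h01 : ∀ A : Finset E, ρ ((Finset.insertNone A).map Function.Embedding.some) =
      ρ₀ ((Finset.insertNone A).map Function.Embedding.some) + 1)
    (h11 : ∀ A : Finset E, ρ (Finset.insertNone (Finset.insertNone A)) =
      ρ₀ (Finset.insertNone (Finset.insertNone A)) + 1)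
    (h'0 : restrictSome ρ' = restrictSome (restrictSome ρ₀))
    (h'1 : ∀ A, ρ' (Finset.insertNone A) = ρ₀ (Finset.insertNone (Finset.insertNone A))) :
    q * draconianSum q ρ = draconianSum q ρ₀ + (1 - q) * draconianSum q ρ' := by
  have hsub₀ : ∀ A B : Finset E, ρ₀ (Finset.insertNone (Finset.insertNone (A ∪ B))) +
      ρ₀ (((A ∩ B).map Function.Embedding.some).map Function.Embedding.some) ≤
      ρ₀ (Finset.insertNone (A.map Function.Embedding.some)) +
        ρ₀ ((Finset.insertNone B).map Function.Embedding.some) := by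
    intro A B
    convert hsub (Finset.insertNone (A.map Function.Embedding.some))
      ((Finset.insertNone B).map Function.Embedding.some) using 3
    · ext x
      rcases x with _ | _ | x <;> simp
    · ext x
      rcases x with _ | _ | x <;> simp
  have hi : ∀ e, ρ {some (some e)} = ρ₀ {some (some e)} := fun e => by
    simpa [restrictSome] using congrFun h00 {e}
  have hi' : ∀ e, ρ' {some e} = ρ₀ {some (some e)} := fun e => by
    simpa [restrictSome] using congrFun h'0 {e}
  have hmap : ∀ A : Finset E, A.map Function.Embedding.some ⊆ Finset.insertNone A := fun A x hx => by
    obtain ⟨a, ha, rfl⟩ := Finset.mem_map.1 hx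
    exact Finset.some_mem_insertNone.2 ha
  rw [draconianSum_option_option hq hρ₀ hsub₀, draconianSum_option_option hq hρ ?_,
    draconianSum_option hq hρ']
  · simp only [hi, hi', h'1, h00, h'0]
    rw [mul_left_comm q, mul_left_comm (1 - q), ← mul_add]
    congr 1
    rw [Finset.mul_sum, Finset.mul_sum, ← Finset.sum_add_distrib]
    refine Finset.sum_congr rfl fun g hg => ?_
    rw [mem_draconianVectors] at hg
    have hg0 : ∀ A, ∑ e ∈ A, g e ≤
        ρ₀ ((A.map Function.Embedding.some).map Function.Embedding.some) := hg.sum_le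
    -- All three bounds a, b, c grow by one, so a + b - c grows by one as well. After multiplication
    -- by q, the new term is the old one plus (1 - q) q q⁻¹ ^ c, and q q⁻¹ ^ c is the slice of the
    -- merged hyperedge.
    rw [sliceBound_add_one (τ := fun A => ρ₀ (Finset.insertNone (A.map Function.Embedding.some))) h10
        fun A => (hg0 A).trans (restrictSome_le hρ₀ _),
      sliceBound_add_one (τ := fun A => ρ₀ ((Finset.insertNone A).map Function.Embedding.some)) h01
        fun A => (hg0 A).trans (hρ₀ (Finset.map_subset_map.2 (hmap A))),
      sliceBound_add_one (τ := fun A => ρ₀ (Finset.insertNone (Finset.insertNone A))) h11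
        fun A => (hg0 A).trans ((hρ₀ (Finset.map_subset_map.2 (hmap A))).trans
          (restrictSome_le hρ₀ _)), pow_succ]
    push_cast
    field_simp
    ring
  · intro A B
    have h1 := hsub₀ A B
    have h2 := congrFun h00 (A ∩ B)
    have h3 := h10 A
    have h4 := h01 B
    have h5 := h11 (A ∪ B)
    simp only [restrictSome] at h2
    omega

end LocalIdentities

/-! ### Spanning trees with prescribed hyperedge degrees -/

section SpanningTrees

variable {E V : Type*} [DecidableEq E] [DecidableEq V]

/-- The inequalities that describe the hypertrees of the hypergraph with hyperedges `N e`, for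
`e ∈ A`, on `n` vertices. -/
def SatisfiesHypertreeInequalities (N : E → Finset V) (A : Finset E) (n : ℕ) (f : E → ℤ) : Prop :=
  (∀ U ⊆ A, U.Nonempty → ∑ e ∈ U, f e < (U.biUnion N).card) ∧ ∑ e ∈ A, f e = n - 1

/-- The bipartite graph on `A` and `C` in which `e` is joined to the elements of `T e` is
connected: there is no proper cut without crossing edges. -/
def IsCutConnected (T : E → Finset V) (A : Finset E) (C : Finset V) : Prop :=
  ∀ (P : E → Prop) (Q : V → Prop), (∀ e ∈ A, ∀ v ∈ T e, (P e ↔ Q v)) →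
    ((∀ e ∈ A, P e) ∧ ∀ v ∈ C, Q v) ∨ ((∀ e ∈ A, ¬ P e) ∧ ∀ v ∈ C, ¬ Q v)

/-- If `f` violates the inequalities after the deletion of the edge `e₀ v₀`, then a maximal
violating set splits the hypergraph into two smaller ones. -/
theorem SatisfiesHypertreeInequalities.exists_split {N : E → Finset V} {A : Finset E} {n : ℕ}
    {f : E → ℤ} (h : SatisfiesHypertreeInequalities N A n f) (hn : (A.biUnion N).card ≤ n)
    {e₀ : E} {v₀ : V}
    (h' : ¬ SatisfiesHypertreeInequalities (Function.update N e₀ ((N e₀).erase v₀)) A n f) :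
    ∃ U ⊆ A, ∃ N' : E → Finset V, N' = Function.update N e₀ ((N e₀).erase v₀) ∧ e₀ ∈ U ∧
      v₀ ∉ U.biUnion N' ∧ (U.biUnion N').card + 1 ≤ n ∧
      SatisfiesHypertreeInequalities N' U (U.biUnion N').card (f - Pi.single e₀ 1) ∧
      SatisfiesHypertreeInequalities (fun e => N e \ U.biUnion N') (A \ U)
        (n - (U.biUnion N').card) f := by
  set N' := Function.update N e₀ ((N e₀).erase v₀) with hN'
  have hne : ∀ e, e ≠ e₀ → N' e = N e := fun e he => by simp [hN', he]
  have hbu : ∀ W : Finset E, e₀ ∉ W → W.biUnion N' = W.biUnion N := fun W hW =>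
    Finset.biUnion_congr rfl fun e he => hne e fun h => hW (h ▸ he)
  have hsub : ∀ W : Finset E, W.biUnion N ⊆ insert v₀ (W.biUnion N') := by
    intro W v hv
    obtain ⟨e, he, hv⟩ := Finset.mem_biUnion.1 hv
    by_cases hvv : v = v₀
    · exact Finset.mem_insert.2 (Or.inl hvv)
    · refine Finset.mem_insert_of_mem (Finset.mem_biUnion.2 ⟨e, he, ?_⟩)
      by_cases hee : e = e₀
      · subst hee
        simpa [hN', hvv] using hv
      · rwa [hne e hee]
  have hcard : ∀ W : Finset E, (W.biUnion N).card ≤ (W.biUnion N').card + 1 := fun W =>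
    (Finset.card_le_card (hsub W)).trans (Finset.card_insert_le _ _)
  -- Only the strict inequalities can fail, since the total of f is unaffected by the deletion. A
  -- violating set of maximal size is chosen.
  have hex : ∃ U ∈ A.powerset.filter fun U => U.Nonempty ∧
      ((U.biUnion N').card : ℤ) ≤ ∑ e ∈ U, f e, ∀ W ∈ A.powerset.filter fun U => U.Nonempty ∧
      ((U.biUnion N').card : ℤ) ≤ ∑ e ∈ U, f e, W.card ≤ U.card := by
    apply Finset.exists_max_image
    by_contra hempty
    refine h' ⟨fun U hU hUn => ?_, h.2⟩
    by_contra hlt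
    exact hempty ⟨U, by simp [hU, hUn, not_lt.1 hlt]⟩
  obtain ⟨U, hU, hmax⟩ := hex
  simp only [Finset.mem_filter, Finset.mem_powerset] at hU hmax
  obtain ⟨hUA, hUn, hUf⟩ := hU
  have h1 := h.1 U hUA hUn
  have h2 := hcard U
  have he₀ : e₀ ∈ U := by
    by_contra he₀
    rw [hbu U he₀] at hUf
    omega
  have hv₀ : v₀ ∉ U.biUnion N' := by
    intro hv
    have h3 := Finset.card_le_card (hsub U)
    rw [Finset.insert_eq_of_mem hv] at h3
    omega
  have hUN : (U.biUnion N).card ≤ n :=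
    (Finset.card_le_card (Finset.biUnion_subset_biUnion_of_subset_left N hUA)).trans hn
  refine ⟨U, hUA, N', rfl, he₀, hv₀, by omega, ⟨fun W hW hWn => ?_, ?_⟩, fun W hW hWn => ?_, ?_⟩
  · have h3 := h.1 W (hW.trans hUA) hWn
    have h4 := hcard W
    by_cases heW : e₀ ∈ W
    · simp only [Pi.sub_apply, Finset.sum_sub_distrib, Finset.sum_pi_single', if_pos heW]
      omega
    · simp only [Pi.sub_apply, Finset.sum_sub_distrib, Finset.sum_pi_single', if_neg heW]
      rw [hbu W heW]
      omega
  · simp only [Pi.sub_apply, Finset.sum_sub_distrib, Finset.sum_pi_single', if_pos he₀]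
    omega
  · have hdisj : Disjoint W U := Finset.disjoint_of_subset_left hW Finset.sdiff_disjoint
    have heW : e₀ ∉ W := fun h => Finset.disjoint_left.1 hdisj h he₀
    have h3 : W.biUnion (fun e => N e \ U.biUnion N') = W.biUnion N' \ U.biUnion N' := by
      rw [hbu W heW]
      ext v
      simp only [Finset.mem_biUnion, Finset.mem_sdiff]
      tauto
    have h4 : (W.biUnion N' \ U.biUnion N').card + (U.biUnion N').card =
        ((W ∪ U).biUnion N').card := by
      rw [Finset.card_sdiff_add_card, ← Finset.union_biUnion]
    -- If W violated its inequality in the quotient by U, then W ∪ U would be a larger violating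
    -- set.
    by_contra hlt
    have h5 := hmax (W ∪ U) ⟨Finset.union_subset (hW.trans Finset.sdiff_subset) hUA,
      hWn.mono Finset.subset_union_left, by
        rw [Finset.sum_union hdisj]
        rw [h3] at hlt
        omega⟩
    rw [Finset.card_union_of_disjoint hdisj] at h5
    have := hWn.card_pos
    omega
  · have h3 := Finset.sum_sdiff hUA (f := f)
    have h4 := h.2
    push_cast [Nat.cast_sub (show (U.biUnion N').card ≤ n by omega)]
    omega

/-- Induction on the number of edges. An edge whose deletion preserves the inequalities is deleted.
Otherwise `exists_split` yields two smaller systems, and e₀ v₀ joins their solutions. Connectedness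
is expressed by cuts so that the gluing only compares the two sides at this edge. -/
theorem SatisfiesHypertreeInequalities.exists_spanningTree {N : E → Finset V} {A : Finset E}
    {C : Finset V} {f : E → ℤ} (hN : A.biUnion N ⊆ C)
    (h : SatisfiesHypertreeInequalities N A C.card f) :
    ∃ T : E → Finset V, (∀ e ∈ A, T e ⊆ N e ∧ ((T e).card : ℤ) = f e + 1) ∧
      IsCutConnected T A C := by
  induction hm : ∑ e ∈ A, (N e).card using Nat.strong_induction_on generalizing N A C f with
  | _ m ih =>
  by_cases hA : ∀ e ∈ A, N e = ∅
  · have hU : ∀ U ⊆ A, U.biUnion N = ∅ := fun U hU => by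
      rw [Finset.eq_empty_iff_forall_notMem]
      intro v hv
      obtain ⟨e, he, hv⟩ := Finset.mem_biUnion.1 hv
      simp [hA e (hU he)] at hv
    have hle : ∀ e ∈ A, f e ≤ -1 := fun e he => by
      have := h.1 {e} (by simpa) (by simp)
      rw [hU {e} (by simpa)] at this
      simp at this
      omega
    have hsum : ∑ e ∈ A, f e ≤ A.card * (-1) := by
      simpa using Finset.sum_le_card_nsmul A f (-1) hle
    have h2 := h.2
    -- Without edges every value is at most -1, so the total |C| - 1 forces |A| + |C| = 1: a single
    -- vertex, or a single hyperedge of value -1.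
    rcases A.eq_empty_or_nonempty with rfl | hne
    · have hC : C.card = 1 := by
        simp at h2
        omega
      obtain ⟨v, rfl⟩ := Finset.card_eq_one.1 hC
      refine ⟨N, by simp, fun P Q _ => ?_⟩
      by_cases hQ : Q v <;> simp [hQ]
    · have hpos := hne.card_pos
      have hC : C = ∅ := by
        rw [← Finset.card_eq_zero]
        omega
      have hA1 : A.card = 1 := by
        rw [hC] at h2
        simp at h2
        omega
      obtain ⟨e, rfl⟩ := Finset.card_eq_one.1 hA1
      refine ⟨N, ?_, fun P Q _ => ?_⟩
      · intro e' he'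
        obtain rfl := Finset.mem_singleton.1 he'
        simp [hC] at h2
        simp [hA e' (by simp), h2]
      · by_cases hP : P e <;> simp [hP, hC]
  · push Not at hA
    obtain ⟨e₀, he₀, v₀, hv₀⟩ := hA
    have hN' : ∀ e, Function.update N e₀ ((N e₀).erase v₀) e ⊆ N e := fun e => by
      by_cases he : e = e₀
      · subst he
        simp [Finset.erase_subset]
      · simp [he]
    have hlt : ∑ e ∈ A, (Function.update N e₀ ((N e₀).erase v₀) e).card < m := by
      rw [← hm]
      refine Finset.sum_lt_sum (fun e _ => Finset.card_le_card (hN' e)) ⟨e₀, he₀, ?_⟩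
      simpa using Finset.card_erase_lt_of_mem hv₀
    by_cases h' : SatisfiesHypertreeInequalities
      (Function.update N e₀ ((N e₀).erase v₀)) A C.card f
    · obtain ⟨T, hT, hc⟩ := ih _ hlt
        ((Finset.biUnion_mono fun e _ => hN' e).trans hN) h' rfl
      exact ⟨T, fun e he => ⟨(hT e he).1.trans (hN' e), (hT e he).2⟩, hc⟩
    · obtain ⟨U, hUA, N', rfl, he₀U, hv₀U, hn, h1, h2⟩ := h.exists_split (Finset.card_le_card hN) h'
      set N' := Function.update N e₀ ((N e₀).erase v₀)
      have hUC : U.biUnion N' ⊆ C := fun v hv => by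
        obtain ⟨e, he, hv⟩ := Finset.mem_biUnion.1 hv
        exact hN (Finset.mem_biUnion.2 ⟨e, hUA he, hN' e hv⟩)
      obtain ⟨T₁, hT₁, hc₁⟩ := ih _ ((Finset.sum_le_sum_of_subset hUA).trans_lt hlt)
        subset_rfl h1 rfl
      obtain ⟨T₂, hT₂, hc₂⟩ := ih (N := fun e => N e \ U.biUnion N') (A := A \ U)
        (C := C \ U.biUnion N') (f := f) _ (by
          refine lt_of_le_of_lt ?_ hlt
          refine (Finset.sum_le_sum fun e he => ?_).trans
            (Finset.sum_le_sum_of_subset (Finset.sdiff_subset (s := A) (t := U)))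
          have : e ≠ e₀ := fun h => (Finset.mem_sdiff.1 he).2 (h ▸ he₀U)
          simp only [N', Function.update_of_ne this]
          exact Finset.card_le_card Finset.sdiff_subset)
        (by
          intro v hv
          simp only [Finset.mem_biUnion, Finset.mem_sdiff] at hv ⊢
          obtain ⟨e, ⟨he, -⟩, hv, hv'⟩ := hv
          exact ⟨hN (Finset.mem_biUnion.2 ⟨e, he, hv⟩), hv'⟩)
        (by rwa [Finset.card_sdiff_of_subset hUC]) rfl
      have hv₀N : v₀ ∈ C \ U.biUnion N' :=
        Finset.mem_sdiff.2 ⟨hN (Finset.mem_biUnion.2 ⟨e₀, he₀, hv₀⟩), hv₀U⟩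
      have hv₀T : v₀ ∉ T₁ e₀ := fun hv =>
        hv₀U (Finset.mem_biUnion.2 ⟨e₀, he₀U, (hT₁ e₀ he₀U).1 hv⟩)
      -- The first part was solved for f lowered by 1 at e₀; the joining edge to v₀, which lies in
      -- the second part, restores the degree.
      refine ⟨fun e => if e ∈ U then (if e = e₀ then insert v₀ (T₁ e₀) else T₁ e) else T₂ e,
        fun e he => ?_, fun P Q hPQ => ?_⟩
      · by_cases heU : e ∈ U
        · by_cases hee : e = e₀
          · subst hee
            have := hT₁ e heU
            simp only [if_pos heU, if_true]
            refine ⟨Finset.insert_subset hv₀ (this.1.trans (hN' e)), ?_⟩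
            rw [Finset.card_insert_of_notMem hv₀T]
            push_cast
            simp [this.2]
          · have := hT₁ e heU
            simp only [if_pos heU, if_neg hee]
            refine ⟨this.1.trans (hN' e), ?_⟩
            simp [this.2, hee]
        · have := hT₂ e (Finset.mem_sdiff.2 ⟨he, heU⟩)
          simp only [if_neg heU]
          exact ⟨this.1.trans Finset.sdiff_subset, this.2⟩
      · have hj := hPQ e₀ he₀ v₀ (by simp [he₀U])
        have hA' : ∀ (R : E → Prop), (∀ e ∈ U, R e) → (∀ e ∈ A \ U, R e) → ∀ e ∈ A, R e := by
          intro R hR hR' e he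
          by_cases heU : e ∈ U
          · exact hR e heU
          · exact hR' e (Finset.mem_sdiff.2 ⟨he, heU⟩)
        have hC' : ∀ (R : V → Prop), (∀ v ∈ U.biUnion N', R v) →
            (∀ v ∈ C \ U.biUnion N', R v) → ∀ v ∈ C, R v := by
          intro R hR hR' v hv
          by_cases hvU : v ∈ U.biUnion N'
          · exact hR v hvU
          · exact hR' v (Finset.mem_sdiff.2 ⟨hv, hvU⟩)
        have h1 := hc₁ P Q fun e he v hv => hPQ e (hUA he) v (by
          simp only [if_pos he]
          split_ifs with hee
          · subst hee
            exact Finset.mem_insert_of_mem hv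
          · exact hv)
        have h2 := hc₂ P Q fun e he v hv => hPQ e (Finset.mem_sdiff.1 he).1 v (by
          simpa only [if_neg (Finset.mem_sdiff.1 he).2] using hv)
        rcases h1 with ⟨a1, b1⟩ | ⟨a1, b1⟩ <;> rcases h2 with ⟨a2, b2⟩ | ⟨a2, b2⟩
        · exact Or.inl ⟨hA' _ a1 a2, hC' _ b1 b2⟩
        · exact absurd (hj.1 (a1 e₀ he₀U)) (b2 v₀ hv₀N)
        · exact absurd (hj.2 (b2 v₀ hv₀N)) (a1 e₀ he₀U)
        · exact Or.inr ⟨hA' _ a1 a2, hC' _ b1 b2⟩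

end SpanningTrees

/-! ### Hypertrees as integer solutions of linear inequalities -/

section Hypertrees

variable {W : Type*}

/-- The hypergraph on the colour class `Eᶜ` that is induced by a bipartite graph: the vertices of a
hyperedge are its neighbours. -/
noncomputable def inducedHyperedge [Finite W] (H : SimpleGraph W) (E : Set W) (e : E) : Finset W :=
  (H.neighborSet e).toFinite.toFinset

@[simp]
theorem mem_inducedHyperedge [Finite W] {H : SimpleGraph W} {E : Set W} {e : E} {w : W} :
    w ∈ inducedHyperedge H E e ↔ H.Adj e w := by
  simp [inducedHyperedge]

theorem card_inducedHyperedge [Finite W] (H : SimpleGraph W) (E : Set W) (e : E) :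
    (inducedHyperedge H E e).card = (H.neighborSet e).ncard :=
  (Set.ncard_eq_toFinset_card _ _).symm

theorem SimpleGraph.IsAcyclic.card_edgeSet_lt [Finite W] [Nonempty W] {G : SimpleGraph W}
    (h : G.IsAcyclic) : Nat.card G.edgeSet < Nat.card W := by
  obtain ⟨T, hGT, -, hT⟩ :=
    (SimpleGraph.connected_top (V := W)).exists_isTree_le_of_le_of_isAcyclic le_top h
  have h1 := (SimpleGraph.isTree_iff_connected_and_card.1 hT).2
  have h2 : Nat.card G.edgeSet ≤ Nat.card T.edgeSet :=
    Nat.card_mono (Set.toFinite _) (SimpleGraph.edgeSet_mono hGT)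
  omega

theorem SimpleGraph.IsBipartiteWith.anti {G T : SimpleGraph W} {s t : Set W}
    (h : G.IsBipartiteWith s t) (hT : T ≤ G) : T.IsBipartiteWith s t :=
  ⟨h.disjoint, fun _ _ hvw => h.mem_of_adj (hT hvw)⟩

variable [Fintype W] {E : Set W}

theorem sum_card_inducedHyperedge [Fintype E] {T : SimpleGraph W} (hT : T.IsBipartiteWith E Eᶜ) :
    ∑ e : E, (inducedHyperedge T E e).card = Nat.card T.edgeSet := by
  classical
  have h : T.IsBipartiteWith (E.toFinset : Set W) ((Eᶜ).toFinset : Set W) := by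
    simpa only [Set.coe_toFinset] using hT
  have := SimpleGraph.isBipartiteWith_sum_degrees_eq_card_edges h
  rw [Nat.card_eq_fintype_card, ← SimpleGraph.edgeFinset_card, ← this,
    Finset.sum_subtype (p := fun w => w ∈ E) E.toFinset (fun x => Set.mem_toFinset)]
  refine Finset.sum_congr rfl fun e _ => ?_
  rw [card_inducedHyperedge, ← SimpleGraph.card_neighborFinset_eq_degree,
    SimpleGraph.neighborFinset, Set.ncard_eq_toFinset_card']

variable [DecidableEq W]

/-- The forest induced on U and its neighbours has fewer edges than vertices. Distinct incidences
give distinct edges because only one end of an edge lies in E. -/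
theorem SimpleGraph.IsAcyclic.sum_card_inducedHyperedge_lt {T : SimpleGraph W} (hT : T.IsAcyclic)
    (hE : T.IsBipartiteWith E Eᶜ) {U : Finset E} (hU : U.Nonempty) :
    ∑ e ∈ U, (inducedHyperedge T E e).card < U.card + (U.biUnion (inducedHyperedge T E)).card := by
  set S : Finset W := U.map (Function.Embedding.subtype _) ∪ U.biUnion (inducedHyperedge T E)
  have hS1 : ∀ e ∈ U, (e : W) ∈ (S : Set W) := fun e he =>
    Finset.mem_union_left _ (Finset.mem_map_of_mem (Function.Embedding.subtype _) he)
  have hS2 : ∀ e ∈ U, ∀ w ∈ inducedHyperedge T E e, w ∈ (S : Set W) := fun e he w hw =>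
    Finset.mem_union_right _ (Finset.mem_biUnion.2 ⟨e, he, hw⟩)
  obtain ⟨e₀, he₀⟩ := hU
  have : Nonempty (S : Set W) := ⟨⟨e₀, hS1 e₀ he₀⟩⟩
  have h1 := (hT.induce (S : Set W)).card_edgeSet_lt
  have h2 : S.card ≤ U.card + (U.biUnion (inducedHyperedge T E)).card := by
    simpa using Finset.card_union_le (U.map (Function.Embedding.subtype _))
      (U.biUnion (inducedHyperedge T E))
  have h3 : Nat.card (S : Set W) = S.card := by simp
  have h4 : ∑ e ∈ U, (inducedHyperedge T E e).card ≤
      Nat.card (T.induce (S : Set W)).edgeSet := by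
    rw [← Finset.card_sigma, ← Nat.card_eq_finsetCard]
    let φ : ↥(U.sigma (inducedHyperedge T E)) → (T.induce (S : Set W)).edgeSet := fun p =>
      ⟨s(⟨p.1.1, hS1 _ (Finset.mem_sigma.1 p.2).1⟩,
        ⟨p.1.2, hS2 _ (Finset.mem_sigma.1 p.2).1 _ (Finset.mem_sigma.1 p.2).2⟩), by
        simpa using (Finset.mem_sigma.1 p.2).2⟩
    refine Nat.card_le_card_of_injective φ ?_
    rintro ⟨⟨e, w⟩, hp⟩ ⟨⟨e', w'⟩, hp'⟩ heq
    simp only [φ, Subtype.mk.injEq, Sym2.eq_iff] at heq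
    rcases heq with ⟨h, rfl⟩ | ⟨h, h'⟩
    · obtain rfl := Subtype.ext h
      rfl
    · have hw := hE.mem_of_mem_adj e'.2 (mem_inducedHyperedge.1 (Finset.mem_sigma.1 hp').2)
      exact absurd (h ▸ e.2) hw
  omega

theorem biUnion_inducedHyperedge_subset {H : SimpleGraph W} (hE : H.IsBipartiteWith E Eᶜ)
    [Fintype ↑Eᶜ] (U : Finset E) : U.biUnion (inducedHyperedge H E) ⊆ (Eᶜ).toFinset := by
  intro w hw
  obtain ⟨e, -, hw⟩ := Finset.mem_biUnion.1 hw
  exact Set.mem_toFinset.2 (hE.mem_of_mem_adj e.2 (mem_inducedHyperedge.1 hw))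

variable [Fintype E]

/-- The hypertrees of a bipartite graph are described by linear inequalities. -/
theorem isHypertree_iff {H : SimpleGraph W} (hE : H.IsBipartiteWith E Eᶜ) {f : E → ℤ} :
    IsHypertree H E f ↔
      SatisfiesHypertreeInequalities (inducedHyperedge H E) Finset.univ (Eᶜ).ncard f := by
  classical
  have hcard : (Eᶜ).ncard = (Eᶜ).toFinset.card := Set.ncard_eq_toFinset_card' _
  have hW : Nat.card W = Fintype.card E + (Eᶜ).ncard := by
    rw [← Nat.card_eq_fintype_card, Nat.card_coe_set_eq, Set.ncard_add_ncard_compl]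
  constructor
  · rintro ⟨T, hTH, hT, hf⟩
    have hTE := hE.anti hTH
    have hf' : ∀ e : E, f e = (inducedHyperedge T E e).card - 1 := fun e => by
      rw [card_inducedHyperedge, hf e]
      ring
    refine ⟨fun U _ hU => ?_, ?_⟩
    · have h1 := hT.2.sum_card_inducedHyperedge_lt hTE hU
      have h2 : (U.biUnion (inducedHyperedge T E)).card ≤
          (U.biUnion (inducedHyperedge H E)).card :=
        Finset.card_le_card (Finset.biUnion_mono fun e _ w hw => by
          simp only [mem_inducedHyperedge] at hw ⊢
          exact hTH hw)
      simp only [hf', Finset.sum_sub_distrib, Finset.sum_const, nsmul_eq_mul, mul_one]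
      rw [← Nat.cast_sum]
      omega
    · have h1 := sum_card_inducedHyperedge hTE
      have h2 := (SimpleGraph.isTree_iff_connected_and_card.1 hT).2
      simp only [hf', Finset.sum_sub_distrib, Finset.sum_const, nsmul_eq_mul, mul_one,
        Finset.card_univ]
      rw [← Nat.cast_sum]
      omega
  · intro h
    rw [hcard] at h
    obtain ⟨T, hT, hc⟩ := h.exists_spanningTree (biUnion_inducedHyperedge_subset hE _)
    have hTE : ∀ (e : E) (w : W), w ∈ T e → w ∈ Eᶜ := fun e w hw =>
      hE.mem_of_mem_adj e.2 (mem_inducedHyperedge.1 ((hT e (Finset.mem_univ _)).1 hw))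
    let T' : SimpleGraph W :=
      { Adj := fun u w => (∃ h : u ∈ E, w ∈ T ⟨u, h⟩) ∨ ∃ h : w ∈ E, u ∈ T ⟨w, h⟩
        symm := ⟨fun u w => Or.symm⟩
        loopless := ⟨by
          rintro u (⟨h, hu⟩ | ⟨h, hu⟩) <;> exact hTE _ _ hu h⟩ }
    have hadj : ∀ (e : E) (w : W), T'.Adj e w ↔ w ∈ T e := by
      intro e w
      constructor
      · rintro (⟨h, hw⟩ | ⟨h, hw⟩)
        · exact hw
        · exact absurd e.2 (hTE _ _ hw)
      · exact fun hw => Or.inl ⟨e.2, hw⟩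
    have hle : T' ≤ H := by
      rintro u w (⟨h, hw⟩ | ⟨h, hw⟩)
      · exact mem_inducedHyperedge.1 ((hT ⟨u, h⟩ (Finset.mem_univ _)).1 hw)
      · exact (mem_inducedHyperedge.1 ((hT ⟨w, h⟩ (Finset.mem_univ _)).1 hw)).symm
    have hT' : inducedHyperedge T' E = T := by
      ext e w
      simp [hadj]
    have hdeg : ∀ e : E, ((T'.neighborSet e).ncard : ℤ) = f e + 1 := fun e => by
      rw [← card_inducedHyperedge, hT', (hT e (Finset.mem_univ _)).2]
    refine ⟨T', hle, SimpleGraph.isTree_iff_connected_and_card.2 ⟨?_, ?_⟩, hdeg⟩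
    · have hpos : 0 < Nat.card W := by
        by_contra hpos
        have h1 := h.2
        have : IsEmpty E := Fintype.card_eq_zero_iff.1 (by omega)
        simp only [Finset.univ_eq_empty, Finset.sum_empty] at h1
        omega
      have : Nonempty W := (Nat.card_pos_iff.1 hpos).1
      refine SimpleGraph.Connected.mk fun u w => ?_
      -- The vertices reachable from u form a cut without crossing edges; as u itself is reachable,
      -- the cut is everything.
      have hcut := hc (fun e => T'.Reachable u e) (fun x => T'.Reachable u x)
        fun e _ x hx => by
          have : T'.Adj e x := (hadj e x).2 hx
          exact ⟨fun h => h.trans this.reachable, fun h => h.trans this.symm.reachable⟩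
      rcases hcut with ⟨h1, h2⟩ | ⟨h1, h2⟩
      · by_cases hw : w ∈ E
        · exact h1 ⟨w, hw⟩ (Finset.mem_univ _)
        · exact h2 w (Set.mem_toFinset.2 hw)
      · exfalso
        by_cases hu : u ∈ E
        · exact h1 ⟨u, hu⟩ (Finset.mem_univ _) (SimpleGraph.Reachable.refl _)
        · exact h2 u (Set.mem_toFinset.2 hu) (SimpleGraph.Reachable.refl _)
    · rw [← sum_card_inducedHyperedge (hE.anti hle), hT', hW]
      have h1 : ∑ e, ((T e).card : ℤ) = ∑ e, (f e + 1) :=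
        Finset.sum_congr rfl fun e he => (hT e he).2
      rw [Finset.sum_add_distrib, h.2, ← Nat.cast_sum] at h1
      simp only [Finset.sum_const, nsmul_eq_mul, mul_one, Finset.card_univ] at h1
      omega

end Hypertrees

/-! ### Bases of draconian vectors, exchange, and the partition into boxes -/

section DraconianBases

variable {E V : Type*} [DecidableEq V]

/-- The number of vertices of a set of hyperedges. -/
def vertexCount (N : E → Finset V) (A : Finset E) : ℕ := (A.biUnion N).card

theorem monotone_vertexCount (N : E → Finset V) : Monotone (vertexCount N) := fun _ _ h =>
  Finset.card_le_card (Finset.biUnion_subset_biUnion_of_subset_left N h)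

/-- Without empty hyperedges the strict inequality extends to sets on which g vanishes. This gives
tight sets, those with sum + 1 equal to the vertex count, their usual uncrossing. -/
theorem IsDraconian.sum_lt {N : E → Finset V} (hN : ∀ e, (N e).Nonempty) {g : E → ℕ}
    (hg : IsDraconian (vertexCount N) g) {A : Finset E} (hA : A.Nonempty) :
    ∑ e ∈ A, g e < vertexCount N A := by
  rcases Nat.eq_zero_or_pos (∑ e ∈ A, g e) with h | h
  · obtain ⟨e, he⟩ := hA
    rw [h]
    exact (hN e).card_pos.trans_le (Finset.card_le_card (Finset.subset_biUnion_of_mem N he))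
  · exact hg A h

variable [DecidableEq E]

theorem vertexCount_union_add (N : E → Finset V) (A B : Finset E) :
    vertexCount N (A ∪ B) + (A.biUnion N ∩ B.biUnion N).card = vertexCount N A + vertexCount N B := by
  rw [vertexCount, Finset.union_biUnion, Finset.card_union_add_card_inter]
  rfl

theorem vertexCount_inter_le (N : E → Finset V) (A B : Finset E) :
    vertexCount N (A ∩ B) ≤ (A.biUnion N ∩ B.biUnion N).card :=
  Finset.card_le_card (Finset.subset_inter
    (Finset.biUnion_subset_biUnion_of_subset_left N Finset.inter_subset_left)
    (Finset.biUnion_subset_biUnion_of_subset_left N Finset.inter_subset_right))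

theorem vertexCount_union_add_inter_le (N : E → Finset V) (A B : Finset E) :
    vertexCount N (A ∪ B) + vertexCount N (A ∩ B) ≤ vertexCount N A + vertexCount N B := by
  have h1 := vertexCount_union_add N A B
  have h2 := vertexCount_inter_le N A B
  omega

theorem sum_add_single (f : E → ℕ) (e : E) (A : Finset E) :
    ∑ x ∈ A, (f + Pi.single e 1 : E → ℕ) x = ∑ x ∈ A, f x + if e ∈ A then 1 else 0 := by
  simp [Finset.sum_add_distrib]

variable [Fintype E] {N : E → Finset V}

/-- A draconian vector of the maximal possible size. -/
def IsDraconianBase (N : E → Finset V) (f : E → ℕ) : Prop :=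
  IsDraconian (vertexCount N) f ∧ ∑ e, f e + 1 = vertexCount N Finset.univ

/-- The hyperedge `e` can pass a unit of `f` to a smaller hyperedge. -/
def CanPassUnit (N : E → Finset V) (r : E → E → Prop) (f : E → ℕ) (e : E) : Prop :=
  ∃ e', r e' e ∧ ∃ h, IsDraconianBase N h ∧ h + Pi.single e 1 = f + Pi.single e' 1

/-- In a connected hypergraph every draconian vector is dominated by a base. -/
theorem IsDraconian.exists_base_ge [Nonempty E] (hN : ∀ e, (N e).Nonempty)
    (hconn : ∀ U : Finset E, U.Nonempty → U ≠ Finset.univ →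
      ¬ Disjoint (U.biUnion N) (Uᶜ.biUnion N))
    {g : E → ℕ} (hg : IsDraconian (vertexCount N) g) : ∃ f, IsDraconianBase N f ∧ g ≤ f := by
  obtain ⟨f, ⟨hf, hgf⟩, hmax⟩ : ∃ f ∈ {f | IsDraconian (vertexCount N) f ∧ g ≤ f},
      ∀ f' ∈ {f | IsDraconian (vertexCount N) f ∧ g ≤ f}, ∑ e, f' e ≤ ∑ e, f e :=
    Set.exists_max_image _ _ ((finite_setOf_isDraconian _).subset fun f hf => hf.1)
      ⟨g, hg, le_rfl⟩
  -- As f has maximal sum, raising it at e must violate a condition, and the violated set is tight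
  -- and contains e.
  have htight : ∀ e, ∃ U : Finset E, e ∈ U ∧ ∑ x ∈ U, f x + 1 = vertexCount N U := by
    intro e
    have h1 : ¬ IsDraconian (vertexCount N) (f + Pi.single e 1) := fun h => by
      have h2 := hmax _ ⟨h, hgf.trans (by simp)⟩
      rw [sum_add_single] at h2
      simp at h2
    unfold IsDraconian at h1
    push Not at h1
    obtain ⟨U, hpos, hU⟩ := h1
    rw [sum_add_single] at hpos
    rw [sum_add_single] at hU
    by_cases heU : e ∈ U
    · have h2 := hf.sum_lt hN ⟨e, heU⟩
      rw [if_pos heU] at hU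
      exact ⟨U, heU, by omega⟩
    · rcases U.eq_empty_or_nonempty with rfl | hUn
      · simp at hpos
      · have h2 := hf.sum_lt hN hUn
        rw [if_neg heU] at hU
        omega
  refine ⟨f, ⟨hf, ?_⟩, hgf⟩
  obtain ⟨T, ⟨hTn, hT⟩, hTmax⟩ :
      ∃ T ∈ {T : Finset E | T.Nonempty ∧ ∑ x ∈ T, f x + 1 = vertexCount N T},
      ∀ U ∈ {T : Finset E | T.Nonempty ∧ ∑ x ∈ T, f x + 1 = vertexCount N T}, U.card ≤ T.card := by
    obtain ⟨U, hU, hU'⟩ := htight (Classical.arbitrary E)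
    exact Set.exists_max_image _ _ (Set.toFinite _) ⟨U, ⟨_, hU⟩, hU'⟩
  by_cases hTu : T = Finset.univ
  · rwa [hTu] at hT
  exfalso
  obtain ⟨v, hv, hv'⟩ := Finset.not_disjoint_iff.1 (hconn T hTn hTu)
  obtain ⟨b, hb, hvb⟩ := Finset.mem_biUnion.1 hv'
  obtain ⟨S, hbS, hS⟩ := htight b
  have h1 := vertexCount_union_add N T S
  have h2 := Finset.sum_union_inter (s₁ := T) (s₂ := S) (f := f)
  have h3 := hf.sum_lt hN (A := T ∪ S) ⟨b, Finset.mem_union_right _ hbS⟩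
  -- T and S may be disjoint as sets of hyperedges, but connectedness supplies the common vertex v.
  -- Therefore T ∪ S is tight as well, against the maximality of T.
  have h4 : ∑ x ∈ T ∩ S, f x + 1 ≤ (T.biUnion N ∩ S.biUnion N).card := by
    rcases (T ∩ S).eq_empty_or_nonempty with h | h
    · rw [h, Finset.sum_empty]
      exact Finset.card_pos.2
        ⟨v, Finset.mem_inter.2 ⟨hv, Finset.mem_biUnion.2 ⟨b, hbS, hvb⟩⟩⟩
    · exact (hf.sum_lt hN h).trans_le (vertexCount_inter_le N T S)
  have h5 := hTmax (T ∪ S) ⟨⟨b, Finset.mem_union_right _ hbS⟩, by omega⟩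
  have h6 : T ⊂ T ∪ S := ⟨Finset.subset_union_left, fun h =>
    (Finset.mem_compl.1 hb) (h (Finset.mem_union_right _ hbS))⟩
  exact absurd (Finset.card_lt_card h6) (by omega)

/-- The exchange property of bases. -/
theorem IsDraconianBase.exists_exchange (hN : ∀ e, (N e).Nonempty) {f f' : E → ℕ}
    (hf : IsDraconianBase N f) (hf' : IsDraconianBase N f') {e' : E} (he' : f e' < f' e') :
    ∃ e, f' e < f e ∧ ∃ h, IsDraconianBase N h ∧ h + Pi.single e 1 = f + Pi.single e' 1 := by
  -- The whole set is tight for a base. Tight sets through e' are closed under intersection, so the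
  -- smallest one lies in all others.
  obtain ⟨T, ⟨heT, hT⟩, hTmin⟩ :
      ∃ T ∈ {T : Finset E | e' ∈ T ∧ ∑ x ∈ T, f x + 1 = vertexCount N T},
      ∀ U ∈ {T : Finset E | e' ∈ T ∧ ∑ x ∈ T, f x + 1 = vertexCount N T}, T.card ≤ U.card :=
    Set.exists_min_image _ _ (Set.toFinite _) ⟨Finset.univ, Finset.mem_univ _, hf.2⟩
  have hTsub : ∀ S : Finset E, e' ∈ S → ∑ x ∈ S, f x + 1 = vertexCount N S → T ⊆ S := by
    intro S heS hS
    have h1 := vertexCount_union_add_inter_le N T S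
    have h2 := Finset.sum_union_inter (s₁ := T) (s₂ := S) (f := f)
    have h3 := hf.1.sum_lt hN (A := T ∪ S) ⟨e', Finset.mem_union_right _ heS⟩
    have h4 := hf.1.sum_lt hN (A := T ∩ S) ⟨e', Finset.mem_inter.2 ⟨heT, heS⟩⟩
    have h5 := hTmin (T ∩ S) ⟨Finset.mem_inter.2 ⟨heT, heS⟩, by omega⟩
    have h6 := Finset.eq_of_subset_of_card_le (Finset.inter_subset_left (s₁ := T) (s₂ := S)) h5
    exact Finset.inter_eq_left.1 h6
  -- On the tight set T the sum of f' is at most that of f, so the excess of f' at e' is compensated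
  -- somewhere in T.
  obtain ⟨e, heT', he⟩ : ∃ e ∈ T, f' e < f e := by
    by_contra! hle
    have h1 := Finset.sum_lt_sum hle ⟨e', heT, he'⟩
    have h2 := hf'.1.sum_lt hN ⟨e', heT⟩
    omega
  have hne : e ≠ e' := by
    rintro rfl
    omega
  obtain ⟨h, hh⟩ : ∃ h : E → ℕ, h + Pi.single e 1 = f + Pi.single e' 1 := by
    refine ⟨fun x => (f + Pi.single e' 1 : E → ℕ) x - (Pi.single e 1 : E → ℕ) x, ?_⟩
    funext x
    refine Nat.sub_add_cancel ?_
    by_cases hx : x = e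
    · subst hx
      simp only [Pi.single_eq_same, Pi.add_apply]
      omega
    · simp [hx]
  have hsum : ∀ A : Finset E, ∑ x ∈ A, h x + (if e ∈ A then 1 else 0) =
      ∑ x ∈ A, f x + if e' ∈ A then 1 else 0 := fun A => by
    rw [← sum_add_single, ← sum_add_single, hh]
  refine ⟨e, he, h, ⟨fun A hA => ?_, ?_⟩, hh⟩
  · have h1 := hsum A
    have hAn : A.Nonempty := by
      by_contra hAn
      rw [Finset.not_nonempty_iff_eq_empty.1 hAn] at hA
      simp at hA
    have h2 := hf.1.sum_lt hN hAn
    by_cases h3 : e' ∈ A <;> by_cases h4 : e ∈ A <;> simp only [h3, h4, if_true, if_false] at h1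
    · omega
    -- Only a set containing e' but not e gains a unit. It is not tight, since otherwise it would
    -- contain T and hence e.
    · have h5 : ∑ x ∈ A, f x + 1 ≠ vertexCount N A := fun h5 => h4 (hTsub A h3 h5 heT')
      omega
    · omega
    · omega
  · have h1 := hsum Finset.univ
    simp only [Finset.mem_univ, if_true] at h1
    have h2 := hf.2
    omega

variable {r : E → E → Prop} [IsStrictTotalOrder E r]

/-- Every draconian vector `g` is dominated by a base that agrees with `g` at all hyperedges that
can pass a unit to a smaller one. -/
theorem IsDraconian.exists_greedy_base [Nonempty E] (hN : ∀ e, (N e).Nonempty)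
    (hconn : ∀ U : Finset E, U.Nonempty → U ≠ Finset.univ →
      ¬ Disjoint (U.biUnion N) (Uᶜ.biUnion N))
    {g : E → ℕ} (hg : IsDraconian (vertexCount N) g) :
    ∃ f, IsDraconianBase N f ∧ g ≤ f ∧ ∀ e, CanPassUnit N r f e → g e = f e := by
  classical
  let rank : E → ℕ := fun e => (Finset.univ.filter fun x => r x e).card
  have hrank : ∀ e' e, r e' e → rank e' < rank e := by
    intro e' e h
    refine Finset.card_lt_card ⟨fun x hx => ?_, fun hsub => ?_⟩
    · simp only [Finset.mem_filter, Finset.mem_univ, true_and] at hx ⊢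
      exact _root_.trans hx h
    · have := hsub (by simpa using h : e' ∈ _)
      simp only [Finset.mem_filter, Finset.mem_univ, true_and] at this
      exact irrefl _ this
  -- Among the bases above g, one that minimizes the rank-weighted sum works: passing a unit from e
  -- to a smaller hyperedge lowers this sum, and the result stays above g if g e < f e.
  obtain ⟨f, ⟨hf, hgf⟩, hmin⟩ : ∃ f ∈ {f | IsDraconianBase N f ∧ g ≤ f},
      ∀ f' ∈ {f | IsDraconianBase N f ∧ g ≤ f}, ∑ e, rank e * f e ≤ ∑ e, rank e * f' e :=
    Set.exists_min_image _ _ ((finite_setOf_isDraconian _).subset fun f hf => hf.1.1)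
      (hg.exists_base_ge hN hconn)
  refine ⟨f, hf, hgf, ?_⟩
  rintro e ⟨e', hr, h, hh, heq⟩
  by_contra hne
  have hlt : g e < f e := lt_of_le_of_ne (hgf e) hne
  have hee : e ≠ e' := by
    rintro rfl
    exact irrefl _ hr
  have h1 := hmin h ⟨hh, fun x => by
    have hx := congrFun heq x
    have hgx : g x ≤ f x := hgf x
    change g x ≤ h x
    simp only [Pi.add_apply, Pi.single_apply] at hx
    rcases eq_or_ne x e with rfl | hxe
    · rw [if_pos rfl, if_neg hee] at hx
      omega
    · rw [if_neg hxe] at hx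
      omega⟩
  have h2 : ∑ x, rank x * (h + Pi.single e 1 : E → ℕ) x =
      ∑ x, rank x * (f + Pi.single e' 1 : E → ℕ) x := by rw [heq]
  simp only [Pi.add_apply, mul_add, Finset.sum_add_distrib, Pi.single_apply, mul_ite, mul_one,
    mul_zero, Finset.sum_ite_eq', Finset.mem_univ, if_true] at h2
  have := hrank e' e hr
  omega

/-- The base of `IsDraconian.exists_greedy_base` is unique. -/
theorem IsDraconianBase.eq_of_greedy (hN : ∀ e, (N e).Nonempty) {f f' g : E → ℕ}
    (hf : IsDraconianBase N f) (hf' : IsDraconianBase N f') (hgf : g ≤ f) (hgf' : g ≤ f')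
    (h : ∀ e, CanPassUnit N r f e → g e = f e) (h' : ∀ e, CanPassUnit N r f' e → g e = f' e) :
    f = f' := by
  by_contra hne
  have hwf : WellFounded r := Finite.wellFounded_of_trans_of_irrefl r
  have hex : {e | f e ≠ f' e}.Nonempty := Function.ne_iff.1 hne
  have hd := hwf.min_mem _ hex
  set e' := hwf.min _ hex
  -- At the least hyperedge e' where the bases differ, exchange gives e with f' e < f e. Then e'
  -- comes before e, so e can pass a unit in f and g e = f e > f' e ≥ g e.
  have key : ∀ f f' : E → ℕ, IsDraconianBase N f → IsDraconianBase N f' → g ≤ f' →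
      (∀ e, CanPassUnit N r f e → g e = f e) → (∀ e, f e ≠ f' e → ¬ r e e') → ¬ f e' < f' e' := by
    intro f f' hf hf' hgf' h hm hlt
    obtain ⟨e, he, x, hx, hx'⟩ := hf.exists_exchange hN hf' hlt
    have hr : r e' e := by
      rcases trichotomous_of r e' e with hr | hr | hr
      · exact hr
      · subst hr
        omega
      · exact absurd hr (hm e he.ne')
    have h1 := h e ⟨e', hr, x, hx, hx'⟩
    have h2 : g e ≤ f' e := hgf' e
    omega
  have hm : ∀ e, f e ≠ f' e → ¬ r e e' := fun e he => hwf.not_lt_min _ he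
  rcases lt_or_gt_of_ne hd with hlt | hlt
  · exact key f f' hf hf' hgf' h hm hlt
  · exact key f' f hf' hf hgf h' (fun e he => hm e he.symm) hlt

variable {F : Type*} [Field F]

/-- The weighted sum over the draconian vectors of a connected hypergraph as a sum over bases. -/
theorem sum_prod_multWeight_eq_sum_bases [Nonempty E] (hN : ∀ e, (N e).Nonempty)
    (hconn : ∀ U : Finset E, U.Nonempty → U ≠ Finset.univ →
      ¬ Disjoint (U.biUnion N) (Uᶜ.biUnion N))
    {q : F} (hq : q ≠ 0) {B : Finset (E → ℕ)} (hB : ∀ f, f ∈ B ↔ IsDraconianBase N f) :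
    ∑ g ∈ draconianVectors (vertexCount N), ∏ e, multWeight q (g e) =
      ∑ f ∈ B, (1 - q) ^ {e | CanPassUnit N r f e}.ncard *
        q⁻¹ ^ (vertexCount N Finset.univ - 1) := by
  classical
  -- The box of f: coordinates at hyperedges that can pass a unit are frozen at f e, the others run
  -- from 0 to f e. The boxes of the bases partition the draconian vectors.
  let t : (E → ℕ) → E → Finset ℕ := fun f e =>
    if CanPassUnit N r f e then {f e} else Finset.range (f e + 1)
  have ht : ∀ f g, g ∈ Fintype.piFinset (t f) ↔
      g ≤ f ∧ ∀ e, CanPassUnit N r f e → g e = f e := by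
    intro f g
    simp only [Fintype.mem_piFinset, t]
    constructor
    · intro h
      refine ⟨fun e => ?_, fun e he => by simpa [he] using h e⟩
      have := h e
      split_ifs at this
      · simp_all
      · simp at this
        omega
    · rintro ⟨h1, h2⟩ e
      split_ifs with he
      · simp [h2 e he]
      · have := h1 e
        simp
        omega
  have hD : draconianVectors (vertexCount N) = B.biUnion fun f => Fintype.piFinset (t f) := by
    ext g
    simp only [mem_draconianVectors, Finset.mem_biUnion, ht, hB]
    constructor
    · intro hg
      exact hg.exists_greedy_base hN hconn
    · rintro ⟨f, hf, hgf, -⟩ A hA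
      have hle : ∑ e ∈ A, g e ≤ ∑ e ∈ A, f e := Finset.sum_le_sum fun e _ => hgf e
      exact hle.trans_lt (hf.1 A (hA.trans_le hle))
  rw [hD, Finset.sum_biUnion]
  · refine Finset.sum_congr rfl fun f hf => ?_
    rw [hB] at hf
    rw [← Finset.prod_univ_sum]
    have hfac : ∀ e, ∑ k ∈ t f e, multWeight q k =
        (if CanPassUnit N r f e then 1 - q else 1) * q⁻¹ ^ f e := by
      intro e
      simp only [t]
      split_ifs with he
      · obtain ⟨e', hr, h, -, heq⟩ := he
        have hee : e ≠ e' := by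
          rintro rfl
          exact irrefl _ hr
        -- A hyperedge that passes a unit has one, so its frozen weight does contain the factor 1 -
        -- q.
        have hpos : 0 < f e := by
          have := congrFun heq e
          simp [hee] at this
          omega
        rw [Finset.sum_singleton, multWeight_of_pos q hpos]
      · rw [sum_range_succ_multWeight hq, one_mul]
    rw [Finset.prod_congr rfl fun e _ => hfac e, Finset.prod_mul_distrib, Finset.prod_ite,
      Finset.prod_const, Finset.prod_const_one, mul_one, Finset.prod_pow_eq_pow_sum,
      Set.ncard_eq_toFinset_card']
    have := hf.2
    congr 2
    · congr 1
      ext e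
      simp
    · omega
  · intro f hf f' hf' hne
    refine Finset.disjoint_left.2 fun g hg hg' => hne ?_
    rw [ht] at hg hg'
    exact ((hB f).1 hf).eq_of_greedy hN ((hB f').1 hf') hg.1 hg'.1 hg.2 hg'.2

end DraconianBases

/-! ### Interior polynomial of a connected graph as a draconian sum -/

section ConnectedInterior

variable {W : Type*}

/-- The number of neighbours of a set of vertices, which are indexed by `ψ`. -/
noncomputable def neighborCount {X : Type*} (H : SimpleGraph W) (ψ : X → W) (A : Finset X) : ℕ :=
  {w | ∃ x ∈ A, H.Adj (ψ x) w}.ncard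

theorem neighborCount_eq_vertexCount [Finite W] [DecidableEq W] {X : Type*} (H : SimpleGraph W)
    (ψ : X → W) :
    neighborCount H ψ = vertexCount fun x => (H.neighborSet (ψ x)).toFinite.toFinset := by
  funext A
  rw [neighborCount, vertexCount, ← Set.ncard_coe_finset]
  congr 1
  ext w
  simp

theorem monotone_neighborCount [Finite W] {X : Type*} (H : SimpleGraph W) (ψ : X → W) :
    Monotone (neighborCount H ψ) := by
  classical
  rw [neighborCount_eq_vertexCount]
  exact monotone_vertexCount _

theorem SimpleGraph.Connected.forall_of_closed {H : SimpleGraph W} (hH : H.Connected)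
    {S : W → Prop} (hS : ∀ u w, H.Adj u w → S u → S w) {u : W} (hu : S u) (w : W) : S w := by
  obtain ⟨p⟩ := hH.preconnected u w
  induction p with
  | nil => exact hu
  | cons h _ ih => exact ih (hS _ _ h hu)

theorem SimpleGraph.Connected.exists_adj_of_ne {H : SimpleGraph W} (hH : H.Connected) {u w : W}
    (h : u ≠ w) : ∃ x, H.Adj u x := by
  by_contra! hu
  exact h (hH.forall_of_closed (S := fun x => u = x) (by
    rintro _ x hx rfl
    exact absurd hx (hu x)) rfl w)

/-- The one-vertex graph is treated apart, since its hypertree may take the value -1 and so need not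
be a natural vector. -/
theorem interiorPoly_of_subsingleton [Subsingleton W] [Nonempty W] (H : SimpleGraph W) (E : Set W)
    (r : W → W → Prop) [IsStrictTotalOrder W r] : interiorPoly H E r = 1 := by
  have hadj : ∀ (T : SimpleGraph W) u, T.neighborSet u = ∅ := fun T u => by
    ext w
    simp [Subsingleton.elim u w]
  have hset : {f | IsHypertree H E f} = {fun _ => -1} := by
    ext f
    constructor
    · rintro ⟨T, -, -, hf⟩
      funext e
      have := hf e
      rw [hadj, Set.ncard_empty] at this
      push_cast at this
      omega
    · rintro rfl
      exact ⟨H, le_rfl, SimpleGraph.IsTree.of_subsingleton, fun e => by simp⟩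
  have hina : ∀ f, {e | IsInternallyInactive H E r f e} = ∅ := fun f => by
    ext e
    simp only [Set.mem_ofPred_eq, Set.mem_empty_iff_false, iff_false]
    rintro ⟨e', hr, -⟩
    rw [Subsingleton.elim e' e] at hr
    exact irrefl _ hr
  change ∑ᶠ f ∈ {f | IsHypertree H E f}, _ = _
  rw [hset, finsum_mem_singleton, hina, Set.ncard_empty, pow_zero]

variable {F : Type*} [Field F]

theorem draconianSum_zero {E : Type*} [Fintype E] (q : F) :
    draconianSum q (fun _ : Finset E => 0) = q ^ Fintype.card E := by
  have : draconianVectors (fun _ : Finset E => 0) = {0} := by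
    ext g
    simp only [mem_draconianVectors, Finset.mem_singleton]
    constructor
    · intro hg
      funext e
      simpa using hg.sum_le {e}
    · rintro rfl A hA
      simp at hA
  simp [draconianSum, this]

variable [Fintype W] {H : SimpleGraph W} {E : Set W} [Fintype E]

/-- If the two vertex sets were disjoint, U together with its neighbours would be closed under
adjacency. -/
theorem not_disjoint_of_connected [DecidableEq W] (hE : H.IsBipartiteWith E Eᶜ)
    (hH : H.Connected) (U : Finset E) (hU : U.Nonempty) (hU' : U ≠ Finset.univ) :
    ¬ Disjoint (U.biUnion (inducedHyperedge H E)) (Uᶜ.biUnion (inducedHyperedge H E)) := by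
  classical
  intro hdisj
  obtain ⟨a, ha⟩ := hU
  obtain ⟨b, hb⟩ : ∃ b, b ∉ U := by
    by_contra! h
    exact hU' (Finset.eq_univ_iff_forall.2 h)
  have hS := hH.forall_of_closed
    (S := fun w => (∃ e ∈ U, (e : W) = w) ∨ w ∈ U.biUnion (inducedHyperedge H E))
    (by
      rintro u w huw (⟨e, he, rfl⟩ | hu)
      · exact Or.inr (Finset.mem_biUnion.2 ⟨e, he, mem_inducedHyperedge.2 huw⟩)
      · have huE : u ∈ Eᶜ := Set.mem_toFinset.1 (biUnion_inducedHyperedge_subset hE U hu)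
        have hw : w ∈ E := hE.mem_of_mem_adj' huE huw.symm
        by_cases hwU : (⟨w, hw⟩ : E) ∈ U
        · exact Or.inl ⟨_, hwU, rfl⟩
        · exact absurd (Finset.mem_biUnion.2
            ⟨⟨w, hw⟩, Finset.mem_compl.2 hwU, mem_inducedHyperedge.2 huw.symm⟩)
            (Finset.disjoint_left.1 hdisj hu))
    (u := a) (Or.inl ⟨a, ha, rfl⟩) b
  rcases hS with ⟨e, he, heb⟩ | hbN
  · exact hb (Subtype.ext heb ▸ he)
  · exact absurd b.2 (Set.mem_toFinset.1 (biUnion_inducedHyperedge_subset hE U hbN))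

theorem isHypertree_natCast_iff [DecidableEq W] (hE : H.IsBipartiteWith E Eᶜ)
    (hN : ∀ e, (inducedHyperedge H E e).Nonempty) [Nonempty E]
    (hcard : vertexCount (inducedHyperedge H E) Finset.univ = (Eᶜ).ncard) (f : E → ℤ) :
    IsHypertree H E f ↔
      ∃ g, IsDraconianBase (inducedHyperedge H E) g ∧ (fun e => (g e : ℤ)) = f := by
  classical
  rw [isHypertree_iff hE]
  have hpos : ∀ U : Finset E, U.Nonempty → 0 < vertexCount (inducedHyperedge H E) U := by
    rintro U ⟨e, he⟩
    exact (hN e).card_pos.trans_le (Finset.card_le_card (Finset.subset_biUnion_of_mem _ he))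
  constructor
  · rintro ⟨h1, h2⟩
    -- The other hyperedges have total at most n - 1, which is the total of f, so nothing negative
    -- is left for e.
    have hf : ∀ e, 0 ≤ f e := by
      intro e
      have h3 := Finset.add_sum_erase Finset.univ f (Finset.mem_univ e)
      rcases (Finset.univ.erase e).eq_empty_or_nonempty with h | h
      · rw [h, Finset.sum_empty, h2, ← hcard] at h3
        have := hpos _ (Finset.univ_nonempty (α := E))
        omega
      · have h4 := h1 _ (Finset.subset_univ _) h
        have h5 := monotone_vertexCount (inducedHyperedge H E) (Finset.erase_subset e Finset.univ)
        rw [hcard] at h5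
        unfold vertexCount at h5
        omega
    refine ⟨fun e => (f e).toNat, ⟨fun A hA => ?_, ?_⟩, funext fun e => Int.toNat_of_nonneg (hf e)⟩
    · have hAn : A.Nonempty := by
        by_contra hAn
        simp [Finset.not_nonempty_iff_eq_empty.1 hAn] at hA
      have := h1 A (Finset.subset_univ _) hAn
      zify
      simpa only [Int.toNat_of_nonneg (hf _), vertexCount] using this
    · rw [hcard]
      zify
      simp only [Int.toNat_of_nonneg (hf _), h2]
      ring
  · rintro ⟨g, ⟨hg, hg'⟩, rfl⟩
    refine ⟨fun U _ hU => ?_, ?_⟩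
    · have := hg.sum_lt hN hU
      unfold vertexCount at this
      beta_reduce
      exact_mod_cast this
    · rw [hcard] at hg'
      rw [← hg']
      push_cast
      ring

theorem isInternallyInactive_natCast_iff [DecidableEq W] (hE : H.IsBipartiteWith E Eᶜ)
    (hN : ∀ e, (inducedHyperedge H E e).Nonempty) [Nonempty E]
    (hcard : vertexCount (inducedHyperedge H E) Finset.univ = (Eᶜ).ncard) (r : W → W → Prop)
    (g : E → ℕ) (e : E) : IsInternallyInactive H E r (fun e => (g e : ℤ)) e ↔
      CanPassUnit (inducedHyperedge H E) (fun a b : E => r a b) g e := by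
  unfold IsInternallyInactive CanPassUnit
  simp only [isHypertree_natCast_iff hE hN hcard]
  refine exists_congr fun e' => and_congr_right fun _ => exists_congr fun h =>
    and_congr_right fun _ => ?_
  rw [funext_iff, funext_iff]
  refine forall_congr' fun x => ?_
  simp only [transferUnit, Pi.add_apply, Pi.sub_apply, Pi.single_apply]
  split_ifs <;> omega

theorem interiorPoly_of_connected_of_nonempty (hE : H.IsBipartiteWith E Eᶜ) (hH : H.Connected)
    (r : W → W → Prop) [IsStrictTotalOrder W r] (φ : ℤ[X] →+* F) {q : F} (hq : q ≠ 0)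
    (hφ : φ Polynomial.X = 1 - q) (hE1 : E.Nonempty) (hE2 : (Eᶜ).Nonempty) :
    q * φ (interiorPoly H E r) = q ^ (Eᶜ).ncard * draconianSum q (neighborCount H (Subtype.val : E → W)) := by
  classical
  obtain ⟨a, ha⟩ := hE1
  obtain ⟨c, hc⟩ := hE2
  have hne : Nonempty E := ⟨⟨a, ha⟩⟩
  have hN : ∀ e, (inducedHyperedge H E e).Nonempty := fun e => by
    obtain ⟨x, hx⟩ := hH.exists_adj_of_ne (show (e : W) ≠ c from fun h => hc (h ▸ e.2))
    exact ⟨x, mem_inducedHyperedge.2 hx⟩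
  have hcard : vertexCount (inducedHyperedge H E) Finset.univ = (Eᶜ).ncard := by
    rw [vertexCount, ← Set.ncard_coe_finset]
    congr 1
    ext w
    constructor
    · intro hw
      exact Set.mem_toFinset.1 (biUnion_inducedHyperedge_subset hE _ hw)
    · intro hw
      obtain ⟨x, hx⟩ := hH.exists_adj_of_ne (show w ≠ a from fun h => hw (h ▸ ha))
      exact Finset.mem_coe.2 (Finset.mem_biUnion.2
        ⟨⟨x, hE.mem_of_mem_adj' hw hx.symm⟩, Finset.mem_univ _, mem_inducedHyperedge.2 hx.symm⟩)
  have hfin : {g | IsDraconianBase (inducedHyperedge H E) g}.Finite :=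
    (finite_setOf_isDraconian _).subset fun g hg => hg.1
  have hI : interiorPoly H E r = ∑ g ∈ hfin.toFinset, Polynomial.X ^
      {e | CanPassUnit (inducedHyperedge H E) (fun a b : E => r a b) g e}.ncard := by
    have hset : {f | IsHypertree H E f} =
        (fun (g : E → ℕ) (e : E) => (g e : ℤ)) '' {g | IsDraconianBase (inducedHyperedge H E) g} := by
      ext f
      exact isHypertree_natCast_iff hE hN hcard f
    have hinj : Function.Injective fun (g : E → ℕ) (e : E) => (g e : ℤ) := fun g g' h =>
      funext fun e => by simpa using congrFun h e
    change ∑ᶠ f ∈ {f | IsHypertree H E f}, _ = _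
    rw [hset, finsum_mem_image hinj.injOn, finsum_mem_eq_finite_toFinset_sum _ hfin]
    simp only [isInternallyInactive_natCast_iff hE hN hcard]
  have hord : IsStrictTotalOrder E (fun a b : E => r a b) :=
    (Subtype.relEmbedding r (· ∈ E)).isStrictTotalOrder
  have hiso : ∀ e : E, vertexCount (inducedHyperedge H E) {e} ≠ 0 := fun e => by
    simpa [vertexCount] using (hN e).ne_empty
  have hpos : 0 < (Eᶜ).ncard := (Set.ncard_pos).2 ⟨c, hc⟩
  rw [show neighborCount H (Subtype.val : E → W) = vertexCount (inducedHyperedge H E) from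
    neighborCount_eq_vertexCount _ _, draconianSum, sum_prod_multWeight_eq_sum_bases (r := fun a b : E => r a b)
    hN (not_disjoint_of_connected hE hH) hq (B := hfin.toFinset) (by simp), hI, map_sum, hcard]
  simp only [hiso, if_false, Finset.prod_const_one, one_mul, map_pow, hφ]
  rw [← Finset.sum_mul, mul_left_comm, mul_comm q]
  congr 1
  -- Each base has weight q⁻¹ ^ (n - 1) against the prefactor q ^ n; the surplus is the q on the
  -- left.
  obtain ⟨m, hm⟩ := Nat.exists_eq_succ_of_ne_zero hpos.ne'
  rw [hm, Nat.succ_eq_add_one, Nat.add_sub_cancel, pow_succ, inv_pow]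
  field_simp

/-- The interior polynomial of a connected bipartite graph as a sum over draconian vectors. -/
theorem interiorPoly_of_connected (hE : H.IsBipartiteWith E Eᶜ) (hH : H.Connected)
    (r : W → W → Prop) [IsStrictTotalOrder W r] (φ : ℤ[X] →+* F) {q : F} (hq : q ≠ 0)
    (hφ : φ Polynomial.X = 1 - q) :
    q * φ (interiorPoly H E r) = q ^ (Eᶜ).ncard * draconianSum q (neighborCount H (Subtype.val : E → W)) := by
  classical
  rcases subsingleton_or_nontrivial W with hW | hW
  · have := hH.nonempty
    have h0 : neighborCount H (Subtype.val : E → W) = fun _ => 0 := by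
      funext A
      rw [neighborCount, Set.ncard_eq_zero]
      ext w
      simp only [Set.mem_ofPred_eq, Set.mem_empty_iff_false, iff_false]
      rintro ⟨e, -, he⟩
      exact he.ne (Subsingleton.elim _ _)
    -- The single q comes from the prefactor if the vertex is not in E, and from the factor for
    -- empty hyperedges if it is.
    have h1 : (Eᶜ).ncard + Fintype.card E = 1 := by
      rw [← Nat.card_eq_fintype_card, Nat.card_coe_set_eq, add_comm, Set.ncard_add_ncard_compl,
        Nat.card_unique]
    rw [h0, draconianSum_zero, ← pow_add, h1, interiorPoly_of_subsingleton]
    simp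
  · obtain ⟨u, w, huw⟩ := exists_pair_ne W
    obtain ⟨x, hx⟩ := hH.exists_adj_of_ne huw
    have h := hE.mem_of_adj hx
    exact interiorPoly_of_connected_of_nonempty hE hH r φ hq hφ
      (h.elim (fun h => ⟨_, h.1⟩) fun h => ⟨_, h.2⟩) (h.elim (fun h => ⟨_, h.2⟩) fun h => ⟨_, h.1⟩)

end ConnectedInterior

/-! ### Disconnected graphs -/

section Components

variable {W : Type*} [Fintype W] {H : SimpleGraph W} {E : Set W}

theorem ncard_eq_sum_connectedComponent [Fintype H.ConnectedComponent] (S : Set W) :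
    S.ncard = ∑ c : H.ConnectedComponent, {w : c | (w : W) ∈ S}.ncard := by
  classical
  rw [Set.ncard_eq_toFinset_card', Finset.card_eq_sum_card_fiberwise
    (f := H.connectedComponentMk) (t := Finset.univ) (fun _ _ => Finset.mem_coe.2 (Finset.mem_univ _))]
  refine Finset.sum_congr rfl fun c _ => ?_
  rw [← Set.ncard_image_of_injective _ Subtype.val_injective, ← Set.ncard_coe_finset]
  congr 1
  ext w
  simp only [Finset.coe_filter, Set.mem_toFinset, Set.mem_image, Subtype.exists]
  constructor
  · rintro ⟨hw, hc⟩
    exact ⟨w, hc, hw, rfl⟩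
  · rintro ⟨_, hc, hw, rfl⟩
    exact ⟨hw, hc⟩

/-- The hyperedges of a graph are distributed among its components. -/
noncomputable def sigmaComponentEquiv (H : SimpleGraph W) (E : Set W) :
    (Σ c : H.ConnectedComponent, {w : c | (w : W) ∈ E}) ≃ E where
  toFun p := ⟨p.2.1, p.2.2⟩
  invFun e := ⟨H.connectedComponentMk e, ⟨⟨e, rfl⟩, e.2⟩⟩
  left_inv := by
    rintro ⟨c, ⟨⟨w, hw⟩, hE⟩⟩
    obtain rfl : H.connectedComponentMk w = c := hw
    rfl
  right_inv _ := rfl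

theorem neighborCount_sigma [Fintype H.ConnectedComponent]
    (A : ∀ c : H.ConnectedComponent, Finset {w : c | (w : W) ∈ E}) :
    neighborCount H (Subtype.val : E → W) ((Finset.univ.sigma A).map (sigmaComponentEquiv H E).toEmbedding) =
      ∑ c : H.ConnectedComponent, neighborCount c.toSimpleGraph (Subtype.val : {w : c | (w : W) ∈ E} → c) (A c) := by
  rw [neighborCount, ncard_eq_sum_connectedComponent (H := H)]
  refine Finset.sum_congr rfl fun c _ => ?_
  rw [neighborCount]
  congr 1
  ext w
  simp only [Set.mem_ofPred_eq]
  constructor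
  · rintro ⟨e, he, hw⟩
    obtain ⟨⟨c', e⟩, he, rfl⟩ := Finset.mem_map.1 he
    obtain rfl : c' = c := by
      have h1 : H.connectedComponentMk e.1 = c' := e.1.2
      have h2 : H.connectedComponentMk w.1 = c := w.2
      rw [← h1, ← h2]
      exact SimpleGraph.ConnectedComponent.connectedComponentMk_eq_of_adj hw
    have he' : e ∈ A c' := by simpa using he
    exact ⟨e, he', hw⟩
  · rintro ⟨e, he, hw⟩
    exact ⟨_, Finset.mem_map.2 ⟨⟨c, e⟩, by simpa using he, rfl⟩, hw⟩

/-- The interior polynomial of a possibly disconnected bipartite graph as a sum over draconian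
vectors. -/
theorem interiorPoly'_eq_draconianSum [Nonempty W] [Fintype E] (hE : H.IsBipartiteWith E Eᶜ)
    (r : W → W → Prop) [IsStrictTotalOrder W r] {F : Type*} [Field F] (φ : ℤ[X] →+* F) {q : F}
    (hq : q ≠ 0) (hφ : φ Polynomial.X = 1 - q) :
    q * φ (interiorPoly' H E r) = q ^ (Eᶜ).ncard * draconianSum q (neighborCount H (Subtype.val : E → W)) := by
  classical
  have hk : 0 < Fintype.card H.ConnectedComponent := Fintype.card_pos
  have hc : ∀ c : H.ConnectedComponent,
      q * φ (interiorPoly c.toSimpleGraph {w : c | (w : W) ∈ E} fun w w' : c => r w w') =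
        q ^ ({w : c | (w : W) ∈ Eᶜ}).ncard *
          draconianSum q (neighborCount c.toSimpleGraph (Subtype.val : {w : c | (w : W) ∈ E} → c)) := by
    intro c
    have hord : IsStrictTotalOrder c (fun w w' : c => r w w') :=
      (Subtype.relEmbedding r (· ∈ c.supp)).isStrictTotalOrder
    have hEc : c.toSimpleGraph.IsBipartiteWith {w : c | (w : W) ∈ E} {w : c | (w : W) ∈ E}ᶜ :=
      ⟨disjoint_compl_right, fun u w huw => hE.mem_of_adj huw⟩
    exact interiorPoly_of_connected hEc c.connected_toSimpleGraph _ φ hq hφ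
  -- The factor (1 - X) ^ (k - 1) becomes q ^ (k - 1). With the q on the left this makes one q for
  -- each of the k components.
  rw [interiorPoly', map_mul, map_pow, map_sub, map_one, hφ, sub_sub_cancel,
    finprod_eq_prod_of_fintype, map_prod, Nat.card_eq_fintype_card, ← mul_assoc, ← pow_succ',
    Nat.sub_add_cancel hk, ← Finset.card_univ, ← Finset.prod_const, ← Finset.prod_mul_distrib,
    Finset.prod_congr rfl fun c _ => hc c, Finset.prod_mul_distrib, Finset.prod_pow_eq_pow_sum,
    ← ncard_eq_sum_connectedComponent]
  congr 1
  rw [← draconianSum_congr q (sigmaComponentEquiv H E) (fun _ => rfl)]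
  refine (draconianSum_sigma q neighborCount_sigma fun c => ?_).symm
  simp [neighborCount]

end Components

/-! ### Isolated vertices, leaves and vertices with two neighbours -/

section VertexDeletion

variable {W : Type*} {F : Type*} [Field F]

/-- The weighted sum over the draconian vectors of a bipartite graph, normalized such that it
computes the interior polynomial. -/
noncomputable def hyperedgeSum [Finite W] (q : F) (H : SimpleGraph W) (E : Set W) : F :=
  letI := Fintype.ofFinite E
  q ^ (Eᶜ).ncard * draconianSum q (neighborCount H (Subtype.val : E → W))

/-- The free choice of the index type allows distinguished hyperedges to sit at `none` and `some
none`, as the local identities require. -/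
theorem hyperedgeSum_eq [Finite W] {X : Type*} [Fintype X] (q : F) (H : SimpleGraph W) {E : Set W}
    {ψ : X → W} (hψ : Function.Injective ψ) (hE : ∀ w, w ∈ E ↔ ∃ x, ψ x = w) :
    hyperedgeSum q H E = q ^ (Eᶜ).ncard * draconianSum q (neighborCount H ψ) := by
  let _ := Fintype.ofFinite E
  unfold hyperedgeSum
  congr 1
  let e : X ≃ E := Equiv.ofBijective (fun x => ⟨ψ x, (hE _).2 ⟨x, rfl⟩⟩)
    ⟨fun x y h => hψ (congrArg Subtype.val h), fun ⟨w, hw⟩ => by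
      obtain ⟨x, rfl⟩ := (hE w).1 hw
      exact ⟨x, rfl⟩⟩
  refine (draconianSum_congr q e fun A => ?_).symm
  simp only [neighborCount, Finset.mem_map, Equiv.coe_toEmbedding]
  congr 1
  ext w
  constructor
  · rintro ⟨x, hx, hw⟩
    exact ⟨e x, ⟨x, hx, rfl⟩, hw⟩
  · rintro ⟨_, ⟨x, hx, rfl⟩, hw⟩
    exact ⟨x, hx, hw⟩

theorem neighborCount_congr {X Y : Type*} {ψ : X → W} {ψ' : Y → W} {A : Finset X} {B : Finset Y}
    (H : SimpleGraph W) (h : ∀ w, (∃ x ∈ A, H.Adj (ψ x) w) ↔ ∃ y ∈ B, H.Adj (ψ' y) w) :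
    neighborCount H ψ A = neighborCount H ψ' B :=
  congrArg Set.ncard (Set.ext h)

theorem neighborCount_union_add_inter_le [Finite W] {X : Type*} [DecidableEq X] (H : SimpleGraph W)
    (ψ : X → W) (A B : Finset X) :
    neighborCount H ψ (A ∪ B) + neighborCount H ψ (A ∩ B) ≤
      neighborCount H ψ A + neighborCount H ψ B := by
  classical
  rw [neighborCount_eq_vertexCount]
  exact vertexCount_union_add_inter_le _ A B

variable {H : SimpleGraph W} {E : Set W} {v : W} {H₀ : SimpleGraph {w // w ≠ v}}

theorem setOf_neighbor_eq (hH₀ : ∀ a b, H₀.Adj a b ↔ H.Adj a b) {X : Type*}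
    (ψ : X → {w // w ≠ v}) (A : Finset X) :
    {w | ∃ x ∈ A, H.Adj (ψ x) w} \ {v} = Subtype.val '' {w | ∃ x ∈ A, H₀.Adj (ψ x) w} := by
  ext w
  simp only [Set.mem_sdiff, Set.mem_ofPred_eq, Set.mem_singleton_iff, Set.mem_image,
    Subtype.exists, exists_and_right, exists_eq_right]
  constructor
  · rintro ⟨⟨x, hx, hw⟩, hwv⟩
    exact ⟨hwv, x, hx, (hH₀ _ _).2 hw⟩
  · rintro ⟨hwv, x, hx, hw⟩
    exact ⟨⟨x, hx, (hH₀ _ _).1 hw⟩, hwv⟩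

theorem neighborCount_of_not_adj (hH₀ : ∀ a b, H₀.Adj a b ↔ H.Adj a b) {X : Type*}
    (ψ : X → {w // w ≠ v}) {A : Finset X} (h : ∀ x ∈ A, ¬ H.Adj v (ψ x)) :
    neighborCount H (fun x => (ψ x : W)) A = neighborCount H₀ ψ A := by
  have hv : v ∉ {w | ∃ x ∈ A, H.Adj (ψ x) w} := by
    rintro ⟨x, hx, hw⟩
    exact h x hx hw.symm
  rw [neighborCount, neighborCount, ← Set.ncard_image_of_injective _ Subtype.val_injective,
    ← setOf_neighbor_eq hH₀, Set.sdiff_singleton_eq_self hv]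

theorem neighborCount_of_adj [Finite W] (hH₀ : ∀ a b, H₀.Adj a b ↔ H.Adj a b) {X : Type*}
    (ψ : X → {w // w ≠ v}) {A : Finset X} (h : ∃ x ∈ A, H.Adj v (ψ x)) :
    neighborCount H (fun x => (ψ x : W)) A = neighborCount H₀ ψ A + 1 := by
  have hv : v ∈ {w | ∃ x ∈ A, H.Adj (ψ x) w} := by
    obtain ⟨x, hx, hw⟩ := h
    exact ⟨x, hx, hw.symm⟩
  rw [neighborCount, neighborCount, ← Set.ncard_image_of_injective _ Subtype.val_injective,
    ← setOf_neighbor_eq hH₀, Set.ncard_sdiff_singleton_add_one hv]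

theorem ncard_compl_deleteVertex_of_mem (hv : v ∈ E) :
    ({a : {w // w ≠ v} | (a : W) ∈ E}ᶜ).ncard = (Eᶜ).ncard := by
  rw [← Set.ncard_image_of_injective _ Subtype.val_injective]
  congr 1
  ext w
  simp only [Set.mem_image, Set.mem_compl_iff, Set.mem_ofPred_eq, Subtype.exists,
    exists_and_left, exists_prop, exists_eq_right_right]
  exact ⟨fun h => h.1, fun h => ⟨h, fun hw => h (hw ▸ hv)⟩⟩

theorem ncard_compl_deleteVertex_of_notMem [Finite W] (hv : v ∉ E) :
    ({a : {w // w ≠ v} | (a : W) ∈ E}ᶜ).ncard + 1 = (Eᶜ).ncard := by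
  rw [← Set.ncard_image_of_injective _ Subtype.val_injective,
    ← Set.ncard_sdiff_singleton_add_one (show v ∈ Eᶜ from hv)]
  congr 2
  ext w
  simp only [Set.mem_image, Set.mem_compl_iff, Set.mem_ofPred_eq, Subtype.exists,
    exists_and_left, exists_prop, exists_eq_right_right, Set.mem_sdiff, Set.mem_singleton_iff]

/-! ### The vertex is a hyperedge -/

/-- The hyperedges other than `v`. -/
abbrev OtherHyperedge (E : Set W) (v : W) := {w : W // w ∈ E ∧ w ≠ v}

/-- The hyperedges, with `v` corresponding to `none`. -/
def optionHyperedge (E : Set W) (v : W) (o : Option (OtherHyperedge E v)) : W :=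
  o.elim v Subtype.val

theorem optionHyperedge_injective (E : Set W) (v : W) :
    Function.Injective (optionHyperedge E v) := by
  rintro (_ | ⟨a, ha⟩) (_ | ⟨b, hb⟩) h
  · rfl
  · exact absurd h.symm hb.2
  · exact absurd h ha.2
  · exact congrArg some (Subtype.ext h)

theorem mem_iff_exists_optionHyperedge (hv : v ∈ E) (w : W) :
    w ∈ E ↔ ∃ x, optionHyperedge E v x = w := by
  constructor
  · intro hw
    by_cases h : w = v
    · exact ⟨none, h.symm⟩
    · exact ⟨some ⟨w, hw, h⟩, rfl⟩
  · rintro ⟨_ | ⟨a, ha⟩, rfl⟩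
    · exact hv
    · exact ha.1

theorem hyperedgeSum_deleteVertex_of_mem [Finite W] [Fintype (OtherHyperedge E v)] (q : F)
    (hE : H.IsBipartiteWith E Eᶜ) (hH₀ : ∀ a b, H₀.Adj a b ↔ H.Adj a b) (hv : v ∈ E) :
    hyperedgeSum q H₀ {a | (a : W) ∈ E} =
      q ^ (Eᶜ).ncard * draconianSum q (restrictSome (neighborCount H (optionHyperedge E v))) := by
  rw [hyperedgeSum_eq q H₀ (E := {a : {w // w ≠ v} | (a : W) ∈ E})
    (ψ := fun x : OtherHyperedge E v => ⟨x, x.2.2⟩)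
    (fun x y h => Subtype.ext (congrArg (Subtype.val : {w // w ≠ v} → W) h)) fun w =>
      ⟨fun hw => ⟨⟨w, hw, w.2⟩, rfl⟩, by
        rintro ⟨x, rfl⟩
        exact x.2.1⟩, ncard_compl_deleteVertex_of_mem hv]
  congr 2
  funext A
  rw [← neighborCount_of_not_adj hH₀ _ fun x _ h => hE.mem_of_mem_adj hv h x.2.1, restrictSome]
  exact neighborCount_congr H fun w => by simp [optionHyperedge]

theorem neighborCount_optionHyperedge_none :
    neighborCount H (optionHyperedge E v) {none} = {w | H.Adj v w}.ncard := by
  simp [neighborCount, optionHyperedge]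

theorem hyperedgeSum_of_isolated_of_mem [Finite W] {q : F} (hq : q ≠ 0) (hE : H.IsBipartiteWith E Eᶜ)
    (hH₀ : ∀ a b, H₀.Adj a b ↔ H.Adj a b) (hv : v ∈ E) (h : ∀ w, ¬ H.Adj v w) :
    hyperedgeSum q H E = q * hyperedgeSum q H₀ {a | (a : W) ∈ E} := by
  let _ := Fintype.ofFinite (OtherHyperedge E v)
  rw [hyperedgeSum_deleteVertex_of_mem q hE hH₀ hv,
    hyperedgeSum_eq q H (optionHyperedge_injective E v) (mem_iff_exists_optionHyperedge hv),
    draconianSum_of_isolated_hyperedge hq (monotone_neighborCount _ _)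
      (by simp [neighborCount_optionHyperedge_none, h])]
  ring

theorem hyperedgeSum_of_leaf_of_mem [Finite W] {q : F} (hq : q ≠ 0) (hE : H.IsBipartiteWith E Eᶜ)
    (hH₀ : ∀ a b, H₀.Adj a b ↔ H.Adj a b) (hv : v ∈ E) {u : W} (h : ∀ w, H.Adj v w ↔ w = u) :
    hyperedgeSum q H E = hyperedgeSum q H₀ {a | (a : W) ∈ E} := by
  let _ := Fintype.ofFinite (OtherHyperedge E v)
  rw [hyperedgeSum_deleteVertex_of_mem q hE hH₀ hv,
    hyperedgeSum_eq q H (optionHyperedge_injective E v) (mem_iff_exists_optionHyperedge hv),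
    draconianSum_of_leaf_hyperedge hq (monotone_neighborCount _ _)
      (by simp [neighborCount_optionHyperedge_none, h])]

/-! ### Identification of two vertices -/

/-- The second alternative is the case where X contains neither of the two points. This is the
dichotomy needed in `draconianSum_of_two_vertices`. -/
theorem ncard_image_of_identify {α β : Type*} [Finite α] {π : α → β} {u₁ u₂ : α} (hu : u₁ ≠ u₂)
    (hπ : ∀ a b, π a = π b ↔ a = b ∨ ((a = u₁ ∨ a = u₂) ∧ (b = u₁ ∨ b = u₂))) (X : Set α) :
    (insert u₁ (insert u₂ X)).ncard = (π '' X).ncard + 1 ∨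
      ((insert u₁ (insert u₂ X)).ncard = (π '' X).ncard + 2 ∧ X.ncard = (π '' X).ncard) := by
  have hinj : ∀ Y : Set α, ¬ (u₁ ∈ Y ∧ u₂ ∈ Y) → (π '' Y).ncard = Y.ncard := by
    intro Y hY
    refine Set.InjOn.ncard_image fun a ha b hb hab => ?_
    rcases (hπ a b).1 hab with h | ⟨h1 | h1, h2 | h2⟩
    · exact h
    · rw [h1, h2]
    · subst h1 h2
      exact absurd ⟨ha, hb⟩ hY
    · subst h1 h2
      exact absurd ⟨hb, ha⟩ hY
    · rw [h1, h2]
  by_cases h1 : u₁ ∈ X <;> by_cases h2 : u₂ ∈ X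
  · left
    have h3 : π '' X = π '' (X \ {u₂}) := by
      apply subset_antisymm
      · rintro _ ⟨a, ha, rfl⟩
        by_cases hau : a = u₂
        · exact ⟨u₁, ⟨h1, hu⟩, (hπ _ _).2 (Or.inr ⟨Or.inl rfl, Or.inr hau⟩)⟩
        · exact ⟨a, ⟨ha, hau⟩, rfl⟩
      · exact Set.image_mono Set.sdiff_subset
    rw [Set.insert_eq_of_mem h2, Set.insert_eq_of_mem h1, h3, hinj _ (by simp),
      Set.ncard_sdiff_singleton_add_one h2]
  · left
    rw [Set.insert_comm, Set.insert_eq_of_mem h1, Set.ncard_insert_of_notMem h2,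
      hinj X (fun h => h2 h.2)]
  · left
    rw [Set.insert_eq_of_mem h2, Set.ncard_insert_of_notMem h1, hinj X (fun h => h1 h.1)]
  · right
    have h3 : u₁ ∉ insert u₂ X := by simp [hu, h1]
    rw [Set.ncard_insert_of_notMem h3, Set.ncard_insert_of_notMem h2, hinj X (fun h => h1 h.1)]
    simp

/-- A graph `Hm` on `Q` is obtained from `H₀` by identifying `u₁` and `u₂` along `π`, and `Em` is the
set of hyperedges that corresponds to `E₀`. -/
structure IsIdentification {V Q : Type*} (H₀ : SimpleGraph V) (E₀ : Set V) (u₁ u₂ : V) (π : V → Q)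
    (Hm : SimpleGraph Q) (Em : Set Q) : Prop where
  ne : u₁ ≠ u₂
  surjective : Function.Surjective π
  eq_iff : ∀ a b, π a = π b ↔ a = b ∨ ((a = u₁ ∨ a = u₂) ∧ (b = u₁ ∨ b = u₂))
  mem_iff : ∀ a, π a ∈ Em ↔ a ∈ E₀
  adj_iff : ∀ p q, Hm.Adj p q ↔ ∃ a b, π a = p ∧ π b = q ∧ H₀.Adj a b

namespace IsIdentification

variable {V Q : Type*} {G₀ : SimpleGraph V} {E₀ : Set V} {u₁ u₂ : V} {π : V → Q}
  {Gm : SimpleGraph Q} {Em : Set Q}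

theorem compl_eq (h : IsIdentification G₀ E₀ u₁ u₂ π Gm Em) : Emᶜ = π '' E₀ᶜ := by
  ext p
  obtain ⟨a, rfl⟩ := h.surjective p
  constructor
  · exact fun ha => ⟨a, fun ha' => ha ((h.mem_iff a).2 ha'), rfl⟩
  · rintro ⟨b, hb, hab⟩ ha
    exact hb ((h.mem_iff b).1 (hab ▸ ha))

theorem ncard_compl_of_notMem [Finite V] (h : IsIdentification G₀ E₀ u₁ u₂ π Gm Em) (h₁ : u₁ ∉ E₀)
    (h₂ : u₂ ∉ E₀) : (Emᶜ).ncard + 1 = (E₀ᶜ).ncard := by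
  have := ncard_image_of_identify h.ne h.eq_iff E₀ᶜ
  rw [Set.insert_eq_of_mem (show u₂ ∈ E₀ᶜ from h₂), Set.insert_eq_of_mem (show u₁ ∈ E₀ᶜ from h₁),
    ← h.compl_eq] at this
  omega

theorem eq_of_notMem (h : IsIdentification G₀ E₀ u₁ u₂ π Gm Em) {X : Set V} (h₁ : u₁ ∉ X)
    (h₂ : u₂ ∉ X) {a b : V} (ha : a ∈ X) (hab : π a = π b) : a = b := by
  rcases (h.eq_iff a b).1 hab with hab | ⟨rfl | rfl, -⟩
  · exact hab
  · exact absurd ha h₁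
  · exact absurd ha h₂

theorem ncard_image_of_notMem (h : IsIdentification G₀ E₀ u₁ u₂ π Gm Em) {X : Set V} (h₁ : u₁ ∉ X)
    (h₂ : u₂ ∉ X) : (π '' X).ncard = X.ncard :=
  Set.InjOn.ncard_image fun _ ha _ _ hab => h.eq_of_notMem h₁ h₂ ha hab

theorem neighborCount_eq (h : IsIdentification G₀ E₀ u₁ u₂ π Gm Em) {X Y : Type*} {ψ : X → Q}
    {ψ₀ : Y → V} {A : Finset X} {B : Finset Y}
    (hAB : ∀ a, (∃ x ∈ A, π a = ψ x) ↔ ∃ y ∈ B, a = ψ₀ y) :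
    neighborCount Gm ψ A = (π '' {b | ∃ y ∈ B, G₀.Adj (ψ₀ y) b}).ncard := by
  rw [neighborCount]
  congr 1
  ext p
  simp only [h.adj_iff, Set.mem_ofPred_eq, Set.mem_image]
  constructor
  · rintro ⟨x, hx, a, b, hax, rfl, hab⟩
    obtain ⟨y, hy, rfl⟩ := (hAB a).1 ⟨x, hx, hax⟩
    exact ⟨b, ⟨y, hy, hab⟩, rfl⟩
  · rintro ⟨b, ⟨y, hy, hab⟩, rfl⟩
    obtain ⟨x, hx, hax⟩ := (hAB _).2 ⟨y, hy, rfl⟩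
    exact ⟨x, hx, _, b, hax, rfl, hab⟩

end IsIdentification

theorem hyperedgeSum_of_two_of_mem [Finite W] {q : F} (hq : q ≠ 0) (hE : H.IsBipartiteWith E Eᶜ)
    (hH₀ : ∀ a b, H₀.Adj a b ↔ H.Adj a b) (hv : v ∈ E) {u₁ u₂ : {w // w ≠ v}}
    (h : ∀ w, H.Adj v w ↔ w = u₁ ∨ w = u₂) {Q : Type*} [Finite Q] {π : {w // w ≠ v} → Q}
    {Hm : SimpleGraph Q} {Em : Set Q}
    (hm : IsIdentification H₀ {a | (a : W) ∈ E} u₁ u₂ π Hm Em) :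
    hyperedgeSum q H E =
      hyperedgeSum q H₀ {a | (a : W) ∈ E} + (1 - q) * hyperedgeSum q Hm Em := by
  let _ := Fintype.ofFinite (OtherHyperedge E v)
  have hu₁ : (u₁ : W) ∉ E := hE.mem_of_mem_adj hv ((h u₁).2 (Or.inl rfl))
  have hu₂ : (u₂ : W) ∉ E := hE.mem_of_mem_adj hv ((h u₂).2 (Or.inr rfl))
  let ψ₀ : OtherHyperedge E v → {w // w ≠ v} := fun x => ⟨x, x.2.2⟩
  have hψ₀ : ∀ x, ψ₀ x ∈ {a : {w // w ≠ v} | (a : W) ∈ E} := fun x => x.2.1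
  have hψ₀i : Function.Injective ψ₀ := fun x y h =>
    Subtype.ext (congrArg (Subtype.val : {w // w ≠ v} → W) h)
  have hπψ : ∀ a x, π a = π (ψ₀ x) ↔ a = ψ₀ x := fun a x =>
    ⟨fun hax => (hm.eq_of_notMem hu₁ hu₂ (hψ₀ x) hax.symm).symm, fun hax => hax ▸ rfl⟩
  have hX : ∀ A, restrictSome (neighborCount H (optionHyperedge E v)) A =
      {b | ∃ y ∈ A, H₀.Adj (ψ₀ y) b}.ncard := fun A => by
    change _ = neighborCount H₀ ψ₀ A
    rw [← neighborCount_of_not_adj hH₀ _ fun x _ h => hE.mem_of_mem_adj hv h x.2.1, restrictSome]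
    exact neighborCount_congr H fun w => by simp [optionHyperedge, ψ₀]
  have hXm : ∀ A, neighborCount Hm (fun x => π (ψ₀ x)) A =
      (π '' {b | ∃ y ∈ A, H₀.Adj (ψ₀ y) b}).ncard := fun A =>
    hm.neighborCount_eq fun a => by simp only [hπψ]
  have hXi : ∀ A, neighborCount H (optionHyperedge E v) (Finset.insertNone A) =
      (insert u₁ (insert u₂ {b | ∃ y ∈ A, H₀.Adj (ψ₀ y) b})).ncard := fun A => by
    rw [neighborCount, ← Set.ncard_image_of_injective _ Subtype.val_injective]
    congr 1
    ext w
    simp only [Set.mem_ofPred_eq, Set.mem_image, Set.mem_insert_iff]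
    constructor
    · rintro ⟨_ | x, hx, hw⟩
      · rcases (h w).1 hw with rfl | rfl
        · exact ⟨u₁, Or.inl rfl, rfl⟩
        · exact ⟨u₂, Or.inr (Or.inl rfl), rfl⟩
      · have hwv : w ≠ v := by
          rintro rfl
          exact hE.mem_of_mem_adj x.2.1 hw hv
        exact ⟨⟨w, hwv⟩, Or.inr (Or.inr ⟨x, Finset.some_mem_insertNone.1 hx, (hH₀ _ _).2 hw⟩), rfl⟩
    · rintro ⟨b, rfl | rfl | ⟨x, hx, hb⟩, rfl⟩
      · exact ⟨none, Finset.none_mem_insertNone, (h _).2 (Or.inl rfl)⟩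
      · exact ⟨none, Finset.none_mem_insertNone, (h _).2 (Or.inr rfl)⟩
      · exact ⟨some x, Finset.some_mem_insertNone.2 hx, (hH₀ _ _).1 hb⟩
  -- The identified vertices are not hyperedges, so the prefactor of the contraction has one q less,
  -- which matches the q⁻¹ in the local identity.
  have hn := hm.ncard_compl_of_notMem hu₁ hu₂
  rw [ncard_compl_deleteVertex_of_mem hv] at hn
  rw [hyperedgeSum_deleteVertex_of_mem q hE hH₀ hv,
    hyperedgeSum_eq q H (optionHyperedge_injective E v) (mem_iff_exists_optionHyperedge hv),
    hyperedgeSum_eq q Hm (ψ := fun x => π (ψ₀ x)) (fun x y hxy => hψ₀i ((hπψ _ _).1 hxy))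
      (fun p => by
        obtain ⟨a, rfl⟩ := hm.surjective p
        rw [hm.mem_iff]
        constructor
        · exact fun ha => ⟨⟨a, ha, a.2⟩, rfl⟩
        · rintro ⟨x, hx⟩
          rw [(hπψ a x).1 hx.symm]
          exact hψ₀ x),
    draconianSum_of_two_vertices hq (monotone_neighborCount _ _)
      (ρ' := neighborCount Hm (fun x => π (ψ₀ x))), ← hn, pow_succ]
  · field_simp
  · rw [← insertNone_empty, hXi]
    simp [Set.ncard_pair hm.ne]
  · intro e
    have h1 := hX {e}
    rw [restrictSome, Finset.map_singleton, Function.Embedding.some_apply] at h1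
    rw [h1, hXm, Set.ncard_eq_zero, Set.ncard_eq_zero, Set.image_eq_empty]
  · intro A
    rw [hX, hXm]
    exact Set.ncard_image_le
  · intro A
    rw [hX, hXm, hXi]
    exact ncard_image_of_identify hm.ne hm.eq_iff _

/-! ### The vertex is not a hyperedge -/

/-- Separating the q that belongs to v leaves the prefactor of the graph without v, and produces the
left-hand sides of the local identities for a new vertex. -/
theorem hyperedgeSum_of_notMem [Finite W] {X : Type*} [Fintype X] (q : F) (hv : v ∉ E)
    {ψ : X → {w // w ≠ v}} (hψ : Function.Injective ψ)
    (hr : ∀ w : {w // w ≠ v}, (w : W) ∈ E ↔ ∃ x, ψ x = w) :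
    hyperedgeSum q H E = q ^ ({a : {w // w ≠ v} | (a : W) ∈ E}ᶜ).ncard *
      (q * draconianSum q (neighborCount H fun x => (ψ x : W))) := by
  rw [hyperedgeSum_eq q H (ψ := fun x => (ψ x : W)) (Subtype.val_injective.comp hψ),
    ← ncard_compl_deleteVertex_of_notMem hv, pow_succ, mul_assoc]
  intro w
  constructor
  · intro hw
    obtain ⟨x, hx⟩ := (hr ⟨w, fun h => hv (h ▸ hw)⟩).1 hw
    exact ⟨x, congrArg Subtype.val hx⟩
  · rintro ⟨x, rfl⟩
    exact (hr _).2 ⟨x, rfl⟩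

theorem hyperedgeSum_of_isolated_of_notMem [Finite W] (q : F)
    (hH₀ : ∀ a b, H₀.Adj a b ↔ H.Adj a b) (hv : v ∉ E) (h : ∀ w, ¬ H.Adj v w) :
    hyperedgeSum q H E = q * hyperedgeSum q H₀ {a | (a : W) ∈ E} := by
  set E₀ := {a : {w // w ≠ v} | (a : W) ∈ E}
  let _ := Fintype.ofFinite E₀
  have hr : ∀ w, w ∈ E₀ ↔ ∃ x : E₀, (x : {w // w ≠ v}) = w := fun w => by simp
  rw [hyperedgeSum_of_notMem q hv Subtype.val_injective hr,
    hyperedgeSum_eq q H₀ Subtype.val_injective hr,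
    show (neighborCount H fun x : E₀ => (x : W)) =
      neighborCount H₀ Subtype.val from
      funext fun A => neighborCount_of_not_adj hH₀ _ fun x _ => h _]
  ring

theorem hyperedgeSum_of_leaf_of_notMem [Finite W] {q : F} (hq : q ≠ 0)
    (hE : H.IsBipartiteWith E Eᶜ) (hH₀ : ∀ a b, H₀.Adj a b ↔ H.Adj a b) (hv : v ∉ E)
    {u : {w // w ≠ v}} (h : ∀ w, H.Adj v w ↔ w = u) :
    hyperedgeSum q H E = hyperedgeSum q H₀ {a | (a : W) ∈ E} := by
  set E₀ := {a : {w // w ≠ v} | (a : W) ∈ E}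
  have hu : u ∈ E₀ := hE.mem_of_mem_adj' hv ((h u).2 rfl).symm
  let _ := Fintype.ofFinite (OtherHyperedge E₀ u)
  rw [hyperedgeSum_of_notMem q hv (optionHyperedge_injective E₀ u)
      (mem_iff_exists_optionHyperedge hu),
    hyperedgeSum_eq q H₀ (optionHyperedge_injective E₀ u) (mem_iff_exists_optionHyperedge hu)]
  congr 1
  refine draconianSum_of_leaf_vertex hq (monotone_neighborCount _ _) (monotone_neighborCount _ _)
    (funext fun A => ?_) fun A => ?_
  · refine neighborCount_of_not_adj hH₀ _ fun x hx hadj => ?_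
    obtain ⟨a, ha, rfl⟩ := Finset.mem_map.1 hx
    exact a.2.2 (Subtype.ext ((h _).1 hadj))
  · exact neighborCount_of_adj hH₀ _ ⟨none, Finset.none_mem_insertNone, (h _).2 rfl⟩

/-- The elements of `E` other than `u₁` and `u₂`. -/
abbrev OtherHyperedge₂ {V : Type*} (E : Set V) (u₁ u₂ : V) := {a : V // a ∈ E ∧ a ≠ u₁ ∧ a ≠ u₂}

/-- The elements of `E`, with `u₁` and `u₂` corresponding to `none` and `some none`. -/
def optionHyperedge₂ {V : Type*} (E : Set V) (u₁ u₂ : V)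
    (o : Option (Option (OtherHyperedge₂ E u₁ u₂))) : V :=
  o.elim u₁ fun o => o.elim u₂ Subtype.val

theorem optionHyperedge₂_injective {V : Type*} (E : Set V) {u₁ u₂ : V} (hu : u₁ ≠ u₂) :
    Function.Injective (optionHyperedge₂ E u₁ u₂) := by
  rintro (_ | _ | ⟨a, ha⟩) (_ | _ | ⟨b, hb⟩) h
  · rfl
  · exact absurd h hu
  · exact absurd h.symm hb.2.1
  · exact absurd h.symm hu
  · rfl
  · exact absurd h.symm hb.2.2
  · exact absurd h ha.2.1
  · exact absurd h ha.2.2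
  · exact congrArg some (congrArg some (Subtype.ext h))

theorem mem_iff_exists_optionHyperedge₂ {V : Type*} {E : Set V} {u₁ u₂ : V} (h₁ : u₁ ∈ E)
    (h₂ : u₂ ∈ E) (w : V) : w ∈ E ↔ ∃ x, optionHyperedge₂ E u₁ u₂ x = w := by
  constructor
  · intro hw
    by_cases h : w = u₁
    · exact ⟨none, h.symm⟩
    by_cases h' : w = u₂
    · exact ⟨some none, h'.symm⟩
    · exact ⟨some (some ⟨w, hw, h, h'⟩), rfl⟩
  · rintro ⟨_ | _ | ⟨a, ha⟩, rfl⟩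
    · exact h₁
    · exact h₂
    · exact ha.1

theorem hyperedgeSum_of_two_of_notMem [Finite W] {q : F} (hq : q ≠ 0)
    (hE : H.IsBipartiteWith E Eᶜ) (hH₀ : ∀ a b, H₀.Adj a b ↔ H.Adj a b) (hv : v ∉ E)
    {u₁ u₂ : {w // w ≠ v}} (h : ∀ w, H.Adj v w ↔ w = u₁ ∨ w = u₂) {Q : Type*} [Finite Q]
    {π : {w // w ≠ v} → Q} {Hm : SimpleGraph Q} {Em : Set Q}
    (hm : IsIdentification H₀ {a | (a : W) ∈ E} u₁ u₂ π Hm Em) :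
    hyperedgeSum q H E =
      hyperedgeSum q H₀ {a | (a : W) ∈ E} + (1 - q) * hyperedgeSum q Hm Em := by
  classical
  set E₀ := {a : {w // w ≠ v} | (a : W) ∈ E}
  have hu₁ : u₁ ∈ E₀ := hE.mem_of_mem_adj' hv ((h u₁).2 (Or.inl rfl)).symm
  have hu₂ : u₂ ∈ E₀ := hE.mem_of_mem_adj' hv ((h u₂).2 (Or.inr rfl)).symm
  let _ := Fintype.ofFinite (OtherHyperedge₂ E₀ u₁ u₂)
  let ψm : Option (OtherHyperedge₂ E₀ u₁ u₂) → Q := fun o => o.elim (π u₁) fun x => π x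
  have hπψ : ∀ a (x : OtherHyperedge₂ E₀ u₁ u₂), π a = π x ↔ a = x := fun a x =>
    ⟨fun hax => (hm.eq_of_notMem (X := {x | x ≠ u₁ ∧ x ≠ u₂}) (by simp) (by simp) x.2.2
      hax.symm).symm, fun hax => hax ▸ rfl⟩
  have hπu : ∀ a, π a = π u₁ ↔ a = u₁ ∨ a = u₂ := fun a => by
    rw [hm.eq_iff]
    tauto
  have hψm : Function.Injective ψm := by
    rintro (_ | x) (_ | y) hxy
    · rfl
    · exact absurd ((hπψ u₁ y).1 hxy).symm y.2.2.1
    · exact absurd ((hπψ u₁ x).1 hxy.symm).symm x.2.2.1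
    · exact congrArg some (Subtype.ext ((hπψ x y).1 hxy))
  have hrm : ∀ p, p ∈ Em ↔ ∃ x, ψm x = p := by
    intro p
    obtain ⟨a, rfl⟩ := hm.surjective p
    rw [hm.mem_iff, mem_iff_exists_optionHyperedge₂ hu₁ hu₂]
    constructor
    · rintro ⟨_ | _ | x, rfl⟩
      · exact ⟨none, rfl⟩
      · exact ⟨none, ((hπu u₂).2 (Or.inr rfl)).symm⟩
      · exact ⟨some x, rfl⟩
    · rintro ⟨_ | x, hx⟩
      · rcases (hπu a).1 hx.symm with rfl | rfl
        · exact ⟨none, rfl⟩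
        · exact ⟨some none, rfl⟩
      · exact ⟨some (some x), ((hπψ a x).1 hx.symm).symm⟩
  -- Here u₁ and u₂ are hyperedges, so no neighbourhood of hyperedges contains them and the
  -- identification preserves all vertex counts.
  have hN : ∀ (B : Finset (Option (Option (OtherHyperedge₂ E₀ u₁ u₂)))),
      (π '' {b | ∃ y ∈ B, H₀.Adj (optionHyperedge₂ E₀ u₁ u₂ y) b}).ncard =
        neighborCount H₀ (optionHyperedge₂ E₀ u₁ u₂) B := by
    intro B
    have hno : ∀ u ∈ E₀, u ∉ {b | ∃ y ∈ B, H₀.Adj (optionHyperedge₂ E₀ u₁ u₂ y) b} := by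
      rintro u hu ⟨y, -, hy⟩
      exact hE.mem_of_mem_adj ((mem_iff_exists_optionHyperedge₂ hu₁ hu₂ _).2 ⟨y, rfl⟩)
        ((hH₀ _ _).1 hy) hu
    exact hm.ncard_image_of_notMem (hno _ hu₁) (hno _ hu₂)
  have hn : (Emᶜ).ncard = (E₀ᶜ).ncard := by
    rw [hm.compl_eq]
    exact hm.ncard_image_of_notMem (fun h => h hu₁) (fun h => h hu₂)
  rw [hyperedgeSum_of_notMem q hv (optionHyperedge₂_injective E₀ hm.ne)
      (mem_iff_exists_optionHyperedge₂ hu₁ hu₂),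
    hyperedgeSum_eq q H₀ (optionHyperedge₂_injective E₀ hm.ne)
      (mem_iff_exists_optionHyperedge₂ hu₁ hu₂),
    hyperedgeSum_eq q Hm hψm hrm, hn,
    draconianSum_of_two_hyperedges hq (monotone_neighborCount _ _) (monotone_neighborCount _ _)
      (monotone_neighborCount Hm ψm) (neighborCount_union_add_inter_le H₀ (optionHyperedge₂ E₀ u₁ u₂))]
  · ring
  · funext A
    refine neighborCount_of_not_adj hH₀ _ fun x hx hadj => ?_
    simp only [Finset.mem_map] at hx
    obtain ⟨_, ⟨a, ha, rfl⟩, rfl⟩ := hx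
    rcases (h _).1 hadj with h | h
    · exact a.2.2.1 (Subtype.ext h)
    · exact a.2.2.2 (Subtype.ext h)
  · exact fun A => neighborCount_of_adj hH₀ _
      ⟨none, Finset.none_mem_insertNone, (h _).2 (Or.inl rfl)⟩
  · exact fun A => neighborCount_of_adj hH₀ _
      ⟨some none, Finset.mem_map.2 ⟨none, Finset.none_mem_insertNone, rfl⟩, (h _).2 (Or.inr rfl)⟩
  · exact fun A => neighborCount_of_adj hH₀ _
      ⟨none, Finset.none_mem_insertNone, (h _).2 (Or.inl rfl)⟩
  · funext A
    rw [restrictSome, restrictSome, restrictSome, ← hN]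
    refine hm.neighborCount_eq fun a => ?_
    constructor
    · rintro ⟨x, hx, hax⟩
      obtain ⟨y, hy, rfl⟩ := Finset.mem_map.1 hx
      exact ⟨some (some y), Finset.mem_map_of_mem _ (Finset.mem_map_of_mem _ hy), (hπψ a y).1 hax⟩
    · rintro ⟨x, hx, hax⟩
      obtain ⟨_, hx', rfl⟩ := Finset.mem_map.1 hx
      obtain ⟨y, hy, rfl⟩ := Finset.mem_map.1 hx'
      exact ⟨some y, Finset.mem_map_of_mem _ hy, (hπψ a y).2 hax⟩
  · intro A
    rw [← hN]
    refine hm.neighborCount_eq fun a => ?_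
    constructor
    · rintro ⟨_ | x, hx, hax⟩
      · rcases (hπu a).1 hax with rfl | rfl
        · exact ⟨none, by simp, rfl⟩
        · exact ⟨some none, by simp, rfl⟩
      · exact ⟨some (some x), Finset.some_mem_insertNone.2
          (Finset.some_mem_insertNone.2 (Finset.some_mem_insertNone.1 hx)), (hπψ a x).1 hax⟩
    · rintro ⟨_ | _ | x, hx, hax⟩
      · exact ⟨none, by simp, (hπu a).2 (Or.inl hax)⟩
      · exact ⟨none, by simp, (hπu a).2 (Or.inr hax)⟩
      · exact ⟨some x, Finset.some_mem_insertNone.2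
          (Finset.some_mem_insertNone.1 (Finset.some_mem_insertNone.1 hx)), (hπψ a x).2 hax⟩

end VertexDeletion

/-! ### Recursions for the unsigned interior polynomial -/

section InteriorRecursion

variable {W : Type*} {H : SimpleGraph W} {E : Set W} {v : W}
  {H₀ : SimpleGraph {w // w ≠ v}}

/-- The right side does not involve r, so the polynomial does not depend on the order; this is why
the orders on the three graphs can be unrelated. -/
theorem interiorPoly'_eq_hyperedgeSum [Finite W] [Nonempty W] {F : Type*} [Field F]
    (hE : H.IsBipartiteWith E Eᶜ) (r : W → W → Prop) [IsStrictTotalOrder W r] (φ : ℤ[X] →+* F)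
    {q : F} (hq : q ≠ 0) (hφ : φ Polynomial.X = 1 - q) :
    q * φ (interiorPoly' H E r) = hyperedgeSum q H E := by
  let _ := Fintype.ofFinite W
  let _ := Fintype.ofFinite E
  exact interiorPoly'_eq_draconianSum hE r φ hq hφ

/-- The inclusion of the integer polynomials into the rational functions. -/
noncomputable abbrev toRatFunc : ℤ[X] →+* FractionRing ℤ[X] := algebraMap _ _

theorem toRatFunc_injective : Function.Injective toRatFunc :=
  IsFractionRing.injective ℤ[X] (FractionRing ℤ[X])

theorem one_sub_toRatFunc_X_ne_zero : 1 - toRatFunc Polynomial.X ≠ 0 := by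
  rw [sub_ne_zero, ← map_one toRatFunc]
  intro h
  simpa using congrArg (Polynomial.eval 0) (toRatFunc_injective h)

theorem isBipartiteWith_deleteVertex (hE : H.IsBipartiteWith E Eᶜ)
    (hH₀ : ∀ a b, H₀.Adj a b ↔ H.Adj a b) :
    H₀.IsBipartiteWith {a | (a : W) ∈ E} {a | (a : W) ∈ E}ᶜ :=
  ⟨disjoint_compl_right, fun a b hab => hE.mem_of_adj ((hH₀ a b).1 hab)⟩

theorem IsIdentification.isBipartiteWith {V Q : Type*} {G₀ : SimpleGraph V} {E₀ : Set V} {u₁ u₂ : V}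
    {π : V → Q} {Gm : SimpleGraph Q} {Em : Set Q} (h : IsIdentification G₀ E₀ u₁ u₂ π Gm Em)
    (hE : G₀.IsBipartiteWith E₀ E₀ᶜ) : Gm.IsBipartiteWith Em Emᶜ := by
  refine ⟨disjoint_compl_right, fun p q hpq => ?_⟩
  obtain ⟨a, b, rfl, rfl, hab⟩ := (h.adj_iff _ _).1 hpq
  simpa only [Set.mem_compl_iff, h.mem_iff] using hE.mem_of_adj hab

/-- Some vertex must remain: for the empty graph the exponent k - 1 truncates to 0, and the identity
would fail. -/
theorem interiorPoly'_of_isolated [Finite W] [Nonempty {w // w ≠ v}] (hE : H.IsBipartiteWith E Eᶜ)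
    (hH₀ : ∀ a b, H₀.Adj a b ↔ H.Adj a b) (r : W → W → Prop) [IsStrictTotalOrder W r]
    (r₁ : {w : W // w ≠ v} → {w : W // w ≠ v} → Prop) [IsStrictTotalOrder {w : W // w ≠ v} r₁]
    (h : ∀ w, ¬ H.Adj v w) :
    interiorPoly' H E r = (1 - Polynomial.X) * interiorPoly' H₀ {a | (a : W) ∈ E} r₁ := by
  have := Nonempty.intro v
  have hq := one_sub_toRatFunc_X_ne_zero
  apply toRatFunc_injective
  apply mul_left_cancel₀ hq
  rw [map_mul, map_sub, map_one, mul_left_comm,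
    interiorPoly'_eq_hyperedgeSum hE r _ hq (by ring),
    interiorPoly'_eq_hyperedgeSum (isBipartiteWith_deleteVertex hE hH₀) r₁ _ hq (by ring)]
  by_cases hv : v ∈ E
  · exact hyperedgeSum_of_isolated_of_mem hq hE hH₀ hv h
  · exact hyperedgeSum_of_isolated_of_notMem _ hH₀ hv h

theorem interiorPoly'_of_leaf [Finite W] (hE : H.IsBipartiteWith E Eᶜ)
    (hH₀ : ∀ a b, H₀.Adj a b ↔ H.Adj a b) (r : W → W → Prop) [IsStrictTotalOrder W r]
    (r₁ : {w : W // w ≠ v} → {w : W // w ≠ v} → Prop) [IsStrictTotalOrder {w : W // w ≠ v} r₁]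
    {u : {w // w ≠ v}} (h : ∀ w, H.Adj v w ↔ w = u) :
    interiorPoly' H E r = interiorPoly' H₀ {a | (a : W) ∈ E} r₁ := by
  have := Nonempty.intro v
  have := Nonempty.intro u
  have hq := one_sub_toRatFunc_X_ne_zero
  apply toRatFunc_injective
  apply mul_left_cancel₀ hq
  rw [interiorPoly'_eq_hyperedgeSum hE r _ hq (by ring),
    interiorPoly'_eq_hyperedgeSum (isBipartiteWith_deleteVertex hE hH₀) r₁ _ hq (by ring)]
  by_cases hv : v ∈ E
  · exact hyperedgeSum_of_leaf_of_mem hq hE hH₀ hv h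
  · exact hyperedgeSum_of_leaf_of_notMem hq hE hH₀ hv h

theorem interiorPoly'_of_two [Finite W] (hE : H.IsBipartiteWith E Eᶜ)
    (hH₀ : ∀ a b, H₀.Adj a b ↔ H.Adj a b) (r : W → W → Prop) [IsStrictTotalOrder W r]
    (r₁ : {w : W // w ≠ v} → {w : W // w ≠ v} → Prop) [IsStrictTotalOrder {w : W // w ≠ v} r₁]
    {u₁ u₂ : {w // w ≠ v}} (h : ∀ w, H.Adj v w ↔ w = u₁ ∨ w = u₂) {Q : Type*} [Finite Q]
    {π : {w // w ≠ v} → Q} {Hm : SimpleGraph Q} {Em : Set Q}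
    (hm : IsIdentification H₀ {a | (a : W) ∈ E} u₁ u₂ π Hm Em)
    (r₂ : Q → Q → Prop) [IsStrictTotalOrder Q r₂] :
    interiorPoly' H E r = interiorPoly' H₀ {a | (a : W) ∈ E} r₁ +
      Polynomial.X * interiorPoly' Hm Em r₂ := by
  have := Nonempty.intro v
  have := Nonempty.intro u₁
  have := Nonempty.intro (π u₁)
  have hq := one_sub_toRatFunc_X_ne_zero
  have hE₀ := isBipartiteWith_deleteVertex hE hH₀
  apply toRatFunc_injective
  apply mul_left_cancel₀ hq
  rw [map_add, map_mul, mul_add, mul_left_comm,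
    interiorPoly'_eq_hyperedgeSum hE r _ hq (by ring),
    interiorPoly'_eq_hyperedgeSum hE₀ r₁ _ hq (by ring),
    interiorPoly'_eq_hyperedgeSum (hm.isBipartiteWith hE₀) r₂ _ hq (by ring)]
  by_cases hv : v ∈ E
  · simpa using hyperedgeSum_of_two_of_mem hq hE hH₀ hv h hm
  · simpa using hyperedgeSum_of_two_of_notMem hq hE hH₀ hv h hm

end InteriorRecursion

/-! ### Alternating sums over sets of edges -/

section AlternatingSum

variable {α β R : Type*} [CommRing R]

/-- The alternating sum of `Φ` over the subsets of `N`. -/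
noncomputable def alternatingSum (N : Set α) (Φ : Set α → R) : R :=
  ∑ᶠ (S : Set α) (_ : S ⊆ N), (-1) ^ S.ncard * Φ S

theorem alternatingSum_eq_finsum_mem (N : Set α) (Φ : Set α → R) :
    alternatingSum N Φ = ∑ᶠ S ∈ 𝒫 N, (-1) ^ S.ncard * Φ S := rfl

theorem alternatingSum_congr {N : Set α} {Φ Ψ : Set α → R} (h : ∀ S ⊆ N, Φ S = Ψ S) :
    alternatingSum N Φ = alternatingSum N Ψ :=
  finsum_mem_congr rfl fun S hS => by rw [h S hS]

theorem alternatingSum_add [Finite α] (N : Set α) (Φ Ψ : Set α → R) :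
    alternatingSum N (fun S => Φ S + Ψ S) = alternatingSum N Φ + alternatingSum N Ψ := by
  simp only [alternatingSum_eq_finsum_mem, mul_add]
  exact finsum_mem_add_distrib (Set.toFinite _)

theorem alternatingSum_mul [Finite α] (N : Set α) (c : R) (Φ : Set α → R) :
    alternatingSum N (fun S => c * Φ S) = c * alternatingSum N Φ := by
  simp only [alternatingSum_eq_finsum_mem, mul_left_comm _ c]
  exact (mul_finsum_mem' _ _ (Set.toFinite _)).symm

/-- The subsets pair off as S and S ∪ {a}, which carry opposite signs. -/
theorem alternatingSum_insert [Finite α] {N : Set α} {a : α} (ha : a ∉ N) (Φ : Set α → R) :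
    alternatingSum (insert a N) Φ = alternatingSum N fun S => Φ S - Φ (insert a S) := by
  have hinj : Set.InjOn (insert a) (𝒫 N) := fun S hS T hT hST => by
    rw [← Set.insert_sdiff_self_of_notMem fun h => ha (hS h), hST,
      Set.insert_sdiff_self_of_notMem fun h => ha (hT h)]
  have hdisj : Disjoint (𝒫 N) (insert a '' 𝒫 N) := by
    rw [Set.disjoint_left]
    rintro _ hS ⟨S, -, rfl⟩
    exact ha (hS (Set.mem_insert a S))
  rw [alternatingSum_eq_finsum_mem, Set.powerset_insert,
    finsum_mem_union hdisj (Set.toFinite _) (Set.toFinite _), finsum_mem_image hinj,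
    ← finsum_mem_add_distrib (Set.toFinite _)]
  refine finsum_mem_congr rfl fun S hS => ?_
  rw [Set.ncard_insert_of_notMem fun h => ha (hS h)]
  ring

theorem alternatingSum_image {f : α → β} (hf : Function.Injective f) (N : Set α)
    (Φ : Set β → R) :
    alternatingSum (f '' N) Φ = alternatingSum N fun S => Φ (f '' S) := by
  have h : 𝒫 (f '' N) = Set.image f '' 𝒫 N := by
    ext S
    simp only [Set.mem_powerset_iff, Set.subset_image_iff, Set.mem_image]
  rw [alternatingSum_eq_finsum_mem, h, finsum_mem_image hf.image_injective.injOn]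
  exact finsum_mem_congr rfl fun S _ => by rw [Set.ncard_image_of_injective _ hf]

end AlternatingSum

/-! ### Signed graphs: the edges at the vertex of degree two -/

namespace SignedBipartiteGraph

variable {W 𝓔 : Type*} (G : SignedBipartiteGraph W 𝓔)

theorem isBipartiteWith_deleteEdges (S : Set 𝓔) (b : Bool) :
    (G.deleteEdges S).IsBipartiteWith {w | G.color w = b} {w | G.color w = b}ᶜ := by
  refine ⟨disjoint_compl_right, ?_⟩
  rintro _ _ ⟨ε, -, c, rfl, rfl⟩
  cases b <;> cases c <;> simp [G.color_ends]

theorem deleteEdges_adj_iff (S : Set 𝓔) (v w : W) :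
    (G.deleteEdges S).Adj v w ↔
      ∃ ε, ε ∉ S ∧ G.Incident v ε ∧ w = G.ends ε (!G.color v) := by
  constructor
  · rintro ⟨ε, hε, c, rfl, rfl⟩
    exact ⟨ε, hε, ⟨c, rfl⟩, by rw [G.color_ends]⟩
  · rintro ⟨ε, hε, ⟨c, rfl⟩, rfl⟩
    exact ⟨ε, hε, c, rfl, by rw [G.color_ends]⟩

theorem joined_iff (v w : W) :
    G.Joined v w ↔ ∃ ε, G.Incident v ε ∧ w = G.ends ε (!G.color v) := by
  simpa [deleteEdges, Joined] using G.deleteEdges_adj_iff ∅ v w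

/-- The endpoint of an edge whose colour differs from that of `v`. -/
def otherEnd (v : W) (ε : 𝓔) : {w : W // w ≠ v} :=
  ⟨G.ends ε (!G.color v), fun h => by simpa [G.color_ends] using congrArg G.color h⟩

variable {G} {v : W}

/-- S and S₀ only have to agree away from v, so one statement covers every choice of deleted edges
at v. -/
theorem deleteVertex_deleteEdges_adj {S : Set 𝓔} {S₀ : Set {ε : 𝓔 // ¬ G.Incident v ε}}
    (hS : ∀ ε : {ε : 𝓔 // ¬ G.Incident v ε}, (ε : 𝓔) ∈ S ↔ ε ∈ S₀) (a b : {w : W // w ≠ v}) :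
    ((G.deleteVertex v).deleteEdges S₀).Adj a b ↔ (G.deleteEdges S).Adj a b := by
  constructor
  · rintro ⟨ε, hε, c, rfl, rfl⟩
    exact ⟨ε, fun h => hε ((hS ε).1 h), c, rfl, rfl⟩
  · rintro ⟨ε, hε, c, ha, hb⟩
    have hv : ¬ G.Incident v ε := by
      rintro ⟨d, hd⟩
      by_cases hcd : d = c
      · exact a.2 (by rw [← ha, ← hcd, hd])
      · exact b.2 (by rw [← hb, ← Bool.eq_not.2 hcd, hd])
    exact ⟨⟨ε, hv⟩, fun h => hε ((hS ⟨ε, hv⟩).2 h), c, Subtype.ext ha, Subtype.ext hb⟩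

theorem otherEnd_ne {ε₁ ε₂ : 𝓔} (h₁ : G.Incident v ε₁) (h₂ : G.Incident v ε₂)
    (hpar : ¬ G.Parallel ε₁ ε₂) : G.otherEnd v ε₁ ≠ G.otherEnd v ε₂ := by
  intro h
  have h' : G.ends ε₁ (!G.color v) = G.ends ε₂ (!G.color v) := congrArg Subtype.val h
  have hend : ∀ ε, G.Incident v ε → G.ends ε (G.color v) = v := by
    rintro ε ⟨c, rfl⟩
    rw [G.color_ends]
  refine hpar (funext fun c => ?_)
  by_cases hc : c = G.color v
  · rw [hc, hend _ h₁, hend _ h₂]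
  · rw [Bool.eq_not.2 hc, h']

theorem isIdentification_contractVertex {ε₁ ε₂ : 𝓔}
    (hv : ∀ ε, G.Incident v ε ↔ ε = ε₁ ∨ ε = ε₂) (hpar : ¬ G.Parallel ε₁ ε₂)
    (S₀ : Set {ε : 𝓔 // ¬ G.Incident v ε}) (b : Bool) :
    IsIdentification ((G.deleteVertex v).deleteEdges S₀) {a | G.color a = b}
      (G.otherEnd v ε₁) (G.otherEnd v ε₂) (Quotient.mk (G.contractSetoid v))
      ((G.contractVertex v).deleteEdges S₀) {p | (G.contractVertex v).color p = b} where
  ne := otherEnd_ne ((hv _).2 (Or.inl rfl)) ((hv _).2 (Or.inr rfl)) hpar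
  surjective := Quotient.mk_surjective
  eq_iff a b := by
    have hJ : ∀ a : {w // w ≠ v}, G.Joined v a ↔ a = G.otherEnd v ε₁ ∨ a = G.otherEnd v ε₂ :=
      fun a => by
        simp only [G.joined_iff, hv, or_and_right, exists_or, exists_eq_left, Subtype.ext_iff,
          otherEnd]
    rw [← hJ, ← hJ]
    exact Quotient.eq
  mem_iff _ := Iff.rfl
  adj_iff p q := by
    constructor
    · rintro ⟨ε, hε, c, rfl, rfl⟩
      exact ⟨_, _, rfl, rfl, ε, hε, c, rfl, rfl⟩
    · rintro ⟨_, _, rfl, rfl, ε, hε, c, rfl, rfl⟩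
      exact ⟨ε, hε, c, rfl, rfl⟩

section Recursion

variable [Finite W] (b : Bool) (r : W → W → Prop) [IsStrictTotalOrder W r]
  (r₁ : {w : W // w ≠ v} → {w : W // w ≠ v} → Prop) [IsStrictTotalOrder {w : W // w ≠ v} r₁]
  {ε₁ ε₂ : 𝓔}

theorem interiorPoly'_deleteEdges_of_two (hv : ∀ ε, G.Incident v ε ↔ ε = ε₁ ∨ ε = ε₂)
    (hpar : ¬ G.Parallel ε₁ ε₂)
    (r₂ : Quotient (G.contractSetoid v) → Quotient (G.contractSetoid v) → Prop)
    [IsStrictTotalOrder (Quotient (G.contractSetoid v)) r₂]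
    (S₀ : Set {ε : 𝓔 // ¬ G.Incident v ε}) :
    interiorPoly' (G.deleteEdges (Subtype.val '' S₀)) {w | G.color w = b} r =
      interiorPoly' ((G.deleteVertex v).deleteEdges S₀) {a | (G.deleteVertex v).color a = b} r₁ +
        Polynomial.X * interiorPoly' ((G.contractVertex v).deleteEdges S₀)
          {p | (G.contractVertex v).color p = b} r₂ := by
  refine interiorPoly'_of_two (G.isBipartiteWith_deleteEdges _ b)
    (deleteVertex_deleteEdges_adj fun ε => Subtype.val_injective.mem_set_image) r r₁ (fun w => ?_)
    (isIdentification_contractVertex hv hpar S₀ b) r₂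
  have hS : ∀ ε, G.Incident v ε → ε ∉ Subtype.val '' S₀ := by
    rintro _ hε ⟨ε, -, rfl⟩
    exact ε.2 hε
  rw [deleteEdges_adj_iff]
  constructor
  · rintro ⟨ε, -, hε, rfl⟩
    exact ((hv ε).1 hε).imp (congrArg fun ε => G.ends ε _) (congrArg fun ε => G.ends ε _)
  · rintro (rfl | rfl)
    · exact ⟨ε₁, hS _ ((hv _).2 (Or.inl rfl)), (hv _).2 (Or.inl rfl), rfl⟩
    · exact ⟨ε₂, hS _ ((hv _).2 (Or.inr rfl)), (hv _).2 (Or.inr rfl), rfl⟩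

theorem interiorPoly'_deleteEdges_of_leaf (hv : ∀ ε, G.Incident v ε ↔ ε = ε₁ ∨ ε = ε₂)
    (hne : ε₁ ≠ ε₂) (S₀ : Set {ε : 𝓔 // ¬ G.Incident v ε}) :
    interiorPoly' (G.deleteEdges (insert ε₁ (Subtype.val '' S₀))) {w | G.color w = b} r =
      interiorPoly' ((G.deleteVertex v).deleteEdges S₀)
        {a | (G.deleteVertex v).color a = b} r₁ := by
  have h₁ : G.Incident v ε₁ := (hv _).2 (Or.inl rfl)
  have h₂ : G.Incident v ε₂ := (hv _).2 (Or.inr rfl)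
  refine interiorPoly'_of_leaf (G.isBipartiteWith_deleteEdges _ b)
    (deleteVertex_deleteEdges_adj fun ε => ?_) r r₁ (u := G.otherEnd v ε₂) fun w => ?_
  · have : (ε : 𝓔) ≠ ε₁ := fun h => ε.2 (h ▸ h₁)
    rw [Set.mem_insert_iff, or_iff_right this, Subtype.val_injective.mem_set_image]
  · rw [deleteEdges_adj_iff]
    constructor
    · rintro ⟨ε, hεS, hε, rfl⟩
      rcases (hv ε).1 hε with rfl | rfl
      · exact absurd (Set.mem_insert _ _) hεS
      · rfl
    · rintro rfl
      refine ⟨ε₂, ?_, h₂, rfl⟩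
      rintro (h | ⟨ε, -, h⟩)
      · exact hne h.symm
      · exact ε.2 (h ▸ h₂)

theorem interiorPoly'_deleteEdges_of_isolated (hv : ∀ ε, G.Incident v ε ↔ ε = ε₁ ∨ ε = ε₂)
    (S₀ : Set {ε : 𝓔 // ¬ G.Incident v ε}) :
    interiorPoly' (G.deleteEdges (insert ε₁ (insert ε₂ (Subtype.val '' S₀))))
        {w | G.color w = b} r =
      (1 - Polynomial.X) * interiorPoly' ((G.deleteVertex v).deleteEdges S₀)
        {a | (G.deleteVertex v).color a = b} r₁ := by
  have : Nonempty {w : W // w ≠ v} := ⟨G.otherEnd v ε₁⟩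
  refine interiorPoly'_of_isolated (G.isBipartiteWith_deleteEdges _ b)
    (deleteVertex_deleteEdges_adj fun ε => ?_) r r₁ fun w => ?_
  · have h : ¬ ((ε : 𝓔) = ε₁ ∨ (ε : 𝓔) = ε₂) := fun h => ε.2 ((hv ε).2 h)
    rw [Set.mem_insert_iff, Set.mem_insert_iff, ← or_assoc, or_iff_right h,
      Subtype.val_injective.mem_set_image]
  · rw [deleteEdges_adj_iff]
    rintro ⟨ε, hεS, hε, -⟩
    rcases (hv ε).1 hε with rfl | rfl <;> simp at hεS

end Recursion

theorem signedInteriorPoly_eq_alternatingSum (b : Bool) (r : W → W → Prop) :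
    G.signedInteriorPoly b r = alternatingSum G.negEdges fun S =>
      interiorPoly' (G.deleteEdges S) {w | G.color w = b} r := rfl

theorem mem_image_negEdges_deleteVertex {ε : 𝓔} :
    ε ∈ Subtype.val '' (G.deleteVertex v).negEdges ↔ ε ∈ G.negEdges ∧ ¬ G.Incident v ε := by
  constructor
  · rintro ⟨ε, hε, rfl⟩
    exact ⟨hε, ε.2⟩
  · rintro ⟨h, h'⟩
    exact ⟨⟨ε, h'⟩, h, rfl⟩

theorem signedInteriorPoly_of_opposite_signs [Finite W] [Finite 𝓔] (b : Bool) (r : W → W → Prop)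
    [IsStrictTotalOrder W r]
    (r₂ : Quotient (G.contractSetoid v) → Quotient (G.contractSetoid v) → Prop)
    [IsStrictTotalOrder (Quotient (G.contractSetoid v)) r₂]
    (r₁ : {w : W // w ≠ v} → {w : W // w ≠ v} → Prop) [IsStrictTotalOrder {w : W // w ≠ v} r₁]
    {ε₁ ε₂ : 𝓔} (hv : ∀ ε, G.Incident v ε ↔ ε = ε₁ ∨ ε = ε₂) (hpar : ¬ G.Parallel ε₁ ε₂)
    (h₁ : ε₁ ∈ G.negEdges) (h₂ : ε₂ ∉ G.negEdges) :
    G.signedInteriorPoly b r =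
      Polynomial.X * (G.contractVertex v).signedInteriorPoly b r₂ := by
  have hne : ε₁ ≠ ε₂ := fun h => h₂ (h ▸ h₁)
  have hN : G.negEdges = insert ε₁ (Subtype.val '' (G.deleteVertex v).negEdges) := by
    ext ε
    rw [Set.mem_insert_iff, mem_image_negEdges_deleteVertex, hv]
    grind
  have hε₁ : ε₁ ∉ Subtype.val '' (G.deleteVertex v).negEdges := by
    simp [hv]
  simp only [signedInteriorPoly_eq_alternatingSum]
  rw [hN, alternatingSum_insert hε₁, alternatingSum_image Subtype.val_injective,
    ← alternatingSum_mul]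
  refine alternatingSum_congr fun S _ => ?_
  -- Keeping ε₁ gives A + XB, and deleting it leaves v as a leaf and gives A; the two contributions
  -- of G - v cancel.
  rw [interiorPoly'_deleteEdges_of_two b r r₁ hv hpar r₂,
    interiorPoly'_deleteEdges_of_leaf b r r₁ hv hne]
  ring

end SignedBipartiteGraph

theorem mainTheorem8 {W 𝓔 : Type*} [Finite W] [Finite 𝓔] (G : SignedBipartiteGraph W 𝓔)
    (v : W) (ε₁ ε₂ : 𝓔)
    (hv : ∀ ε, G.Incident v ε ↔ ε = ε₁ ∨ ε = ε₂)
    (hpar : ¬ G.Parallel ε₁ ε₂)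
    -- the colour class that is viewed as the set of hyperedges
    (b : Bool)
    -- arbitrary total orders, with respect to which the activities are computed
    (r : W → W → Prop) [IsStrictTotalOrder W r]
    (r₁ : {w : W // w ≠ v} → {w : W // w ≠ v} → Prop)
    [IsStrictTotalOrder {w : W // w ≠ v} r₁]
    (r₂ : Quotient (G.contractSetoid v) → Quotient (G.contractSetoid v) → Prop)
    [IsStrictTotalOrder (Quotient (G.contractSetoid v)) r₂] :
    (G.sign ε₁ = 1 → G.sign ε₂ = 1 →
      G.signedInteriorPoly b r =
        (G.deleteVertex v).signedInteriorPoly b r₁ +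
          Polynomial.X * (G.contractVertex v).signedInteriorPoly b r₂) ∧
    (G.sign ε₁ = -1 → G.sign ε₂ = -1 →
      G.signedInteriorPoly b r =
        -Polynomial.X * (G.deleteVertex v).signedInteriorPoly b r₁ +
          Polynomial.X * (G.contractVertex v).signedInteriorPoly b r₂) ∧
    (G.sign ε₁ ≠ G.sign ε₂ →
      G.signedInteriorPoly b r =
        Polynomial.X * (G.contractVertex v).signedInteriorPoly b r₂) := by
  have h₁ : G.Incident v ε₁ := (hv _).2 (Or.inl rfl)
  have h₂ : G.Incident v ε₂ := (hv _).2 (Or.inr rfl)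
  have hne : ε₁ ≠ ε₂ := fun h => hpar (h ▸ rfl)
  have hv' : ∀ ε, G.Incident v ε ↔ ε = ε₂ ∨ ε = ε₁ := fun ε => (hv ε).trans or_comm
  have hpar' : ¬ G.Parallel ε₂ ε₁ := fun h => hpar (Eq.symm h)
  have htwo := SignedBipartiteGraph.interiorPoly'_deleteEdges_of_two b r r₁ hv hpar r₂
  have hpos : ∀ ε, G.sign ε = 1 → ε ∉ G.negEdges := fun ε h h' => by
    rw [SignedBipartiteGraph.negEdges, Set.mem_ofPred_eq, h] at h'
    exact absurd h' (by decide)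
  refine ⟨fun hs₁ hs₂ => ?_, fun hs₁ hs₂ => ?_, fun hs => ?_⟩
  · have hN : G.negEdges = Subtype.val '' (G.deleteVertex v).negEdges := by
      ext ε
      rw [SignedBipartiteGraph.mem_image_negEdges_deleteVertex, hv]
      have := hpos ε₁ hs₁
      have := hpos ε₂ hs₂
      grind
    simp only [SignedBipartiteGraph.signedInteriorPoly_eq_alternatingSum]
    rw [hN, alternatingSum_image Subtype.val_injective, ← alternatingSum_mul]
    exact (alternatingSum_congr fun S _ => htwo S).trans (alternatingSum_add _ _ _)
  · have hN : G.negEdges =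
        insert ε₁ (insert ε₂ (Subtype.val '' (G.deleteVertex v).negEdges)) := by
      ext ε
      rw [Set.mem_insert_iff, Set.mem_insert_iff,
        SignedBipartiteGraph.mem_image_negEdges_deleteVertex, hv]
      have hs₁ : ε₁ ∈ G.negEdges := hs₁
      have hs₂ : ε₂ ∈ G.negEdges := hs₂
      grind
    have hε₂ : ε₂ ∉ Subtype.val '' (G.deleteVertex v).negEdges := by
      simp [hv]
    have hε₁ : ε₁ ∉ insert ε₂ (Subtype.val '' (G.deleteVertex v).negEdges) := by
      simp [hv, hne]
    simp only [SignedBipartiteGraph.signedInteriorPoly_eq_alternatingSum]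
    rw [hN, alternatingSum_insert hε₁, alternatingSum_insert hε₂,
      alternatingSum_image Subtype.val_injective, ← alternatingSum_mul, ← alternatingSum_mul]
    refine Eq.trans (alternatingSum_congr fun S _ => ?_) (alternatingSum_add _ _ _)
    -- Deleting neither, one or both edges at v gives A + XB, A twice, and (1 - X)A; the signed
    -- total is -XA + XB.
    rw [htwo, SignedBipartiteGraph.interiorPoly'_deleteEdges_of_leaf b r r₁ hv hne,
      SignedBipartiteGraph.interiorPoly'_deleteEdges_of_leaf b r r₁ hv' hne.symm,
      SignedBipartiteGraph.interiorPoly'_deleteEdges_of_isolated b r r₁ hv]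
    ring
  · have hneg : ∀ ε, G.sign ε = 1 ∨ ε ∈ G.negEdges := fun ε => Int.units_eq_one_or _
    rcases hneg ε₁ with hs₁ | hs₁ <;> rcases hneg ε₂ with hs₂ | hs₂
    · exact absurd (hs₁.trans hs₂.symm) hs
    · exact SignedBipartiteGraph.signedInteriorPoly_of_opposite_signs b r r₂ r₁ hv' hpar' hs₂ (hpos _ hs₁)
    · exact SignedBipartiteGraph.signedInteriorPoly_of_opposite_signs b r r₂ r₁ hv hpar hs₁ (hpos _ hs₂)
    · exact absurd (Eq.trans hs₁ (Eq.symm hs₂)) hs
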